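/- Let $D\ge 1$ and let $\Gamma=\mathbb Z^D$ carry its graph metric, with balls $b_u(N)$. Each site $x$ carries a finite-dimensional Hilbert space $\mathcal H_x$; for finite $\Lambda\subset\Gamma$ put $\mathcal H_\Lambda=\bigotimes_{x\in\Lambda}\mathcal H_x$, and for finite $Z\subset\Gamma$ let a Lindbladian supported in $Z$ be a superoperator in Lindblad form on $\mathcal B(\mathcal H_Z)$, acting on $\mathcal B(\mathcal H_\Lambda)$, $\Lambda\supset Z$, by tensoring with the identity. Write $\|\cdot\|_1$ for the trace norm and $\|\cdot\|_\diamond$ for the diamond norm. A uniform family $\mathcal L=(\mathcal M,\mathcal B)$ consists of Lindbladians $\mathcal M_Z$ supported in $Z$, for all finite $Z\subset\Gamma$, and, for every ball $\Lambda=b_u(N)$, of Lindbladians $\mathcal B^{\partial\Lambda}_d$, $1\le d\le N+1$, supported in $\partial_d\Lambda=\{x\in\Lambda:\operatorname{dist}(x,\Lambda^c)\le d\}$ (since $\partial_{N+1}\Lambda=\Lambda$, larger $d$ would add nothing). Assume that there are $v\ge 0$ and a positive nondecreasing function $\nu$ with $\nu(r+s)\le\nu(r)\nu(s)$ such that $$\sup_{x\in\Gamma}\sum_{Z\ni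 x}\|\mathcal M_Z\|_\diamond\,|Z|\,\nu(\operatorname{diam}Z)\le v,\qquad \sup_{x\in\Gamma}\sup_{r\ge 1}\nu(r)\sum_{d=r}^{N+1}\|\mathcal B_d^{\partial b_x(N)}\|_\diamond\le \mathrm{poly}(N).$$ Call a finite set $\Lambda$ a disjoint union of balls if $\Lambda=\bigcup_i\Lambda_i$ for finitely many balls $\Lambda_i$ with sites of different $\Lambda_i$ at distance at least $2$ (so the $\Lambda_i$ are the connected components of $\Lambda$). For such $\Lambda$ put $\mathcal B^{\partial\Lambda}_d=\sum_i\mathcal B^{\partial\Lambda_i}_d$ and let $$T_t^{\bar\Lambda}=\exp(t\mathcal L^{\bar\Lambda}),\qquad \mathcal L^{\bar\Lambda}=\sum_{Z\subset\Lambda}\mathcal M_Z+\sum_{d\ge 1}\mathcal B_d^{\partial\Lambda}$$ be the evolution with closed boundary. Assume that $\mathcal L$ is frustration free: for every disjoint union of balls $\Lambda$ and every state $\rho_\infty$ on $\Lambda$ fixed by $T_t^{\bar\Lambda}$ for all $t\ge 0$, $\mathcal M_Z(\rho_\infty)=0$ for all $Z\subset\Lambda$. For a finite $A\subset\Gamma$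 and $s\ge 0$ let $A(s)$ denote a disjoint union of balls that contains $\{x:\operatorname{dist}(x,A)\le s\}$ and has the smallest possible number of sites. Then for every finite $A\subset\Gamma$ there is a real polynomial $\mathrm{poly}$ (depending only on the family, $\nu$, $v$ and $A$) such that for every integer $m\ge 1$ and all choices of $A(m)$ and $B=A(m+1)$ with $A(m)\subset A(m+1)$, with $R=A(m+1)\setminus A(m)$, for every state $\rho^m_\infty$ on $A(m)$ that is fixed by $T_t^{\overline{A(m)}}$ for all $t\ge 0$, every state $\tau$ on $R$, and every $t\ge 0$, $$\Big\|\big(T_t^{\bar B}-T_t^{\bar B\setminus A}\big)(\rho^m_\infty\otimes\tau)\Big\|_1\le \mathrm{poly}(m)\,\nu^{-1}(m)\,\big[e^{vt}-1+t\big],$$ where $\nu^{-1}(m)=1/\nu(m)$ and $T_t^{\bar B\setminus A}=\exp(t\mathcal L^{\bar B\setminus A})$ is the evolution on $B$ generated by $$\mathcal L^{\bar B\setminus A}=\sum_{Z\subset B\setminus A}\mathcal M_Z+\sum_{d\le m+1}\mathcal B_d^{\partial B}.$$ -/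

import Mathlib

open scoped ENNReal Matrix ComplexOrder

namespace OpenLattice

noncomputable section

/-! ### Matrices, superoperators, norms -/

/-- Superoperators: linear maps on the algebra of operators, in matrix form. -/
abbrev Superop (ι : Type) : Type := Matrix ι ι ℂ →ₗ[ℂ] Matrix ι ι ℂ

section Norms

variable {ι : Type} [Fintype ι] [DecidableEq ι]

/-- The trace norm `‖X‖₁`, the sum of the singular values of `X`, i.e. of the square roots of the
eigenvalues of `Xᴴ X`. -/
def traceNorm (X : Matrix ι ι ℂ) : ℝ :=
  ∑ i, Real.sqrt ((Matrix.isHermitian_conjTranspose_mul_self X).eigenvalues i)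

/-- `T ⊗ id` on `B(ℂ^ι) ⊗ M_n`. -/
def ampliate (T : Superop ι) (n : ℕ) (X : Matrix (ι × Fin n) (ι × Fin n) ℂ) :
    Matrix (ι × Fin n) (ι × Fin n) ℂ :=
  Matrix.of fun p r => T (Matrix.of fun a b => X (a, p.2) (b, r.2)) p.1 r.1

/-- The diamond norm `sup_n ‖T ⊗ id_n‖_{1 → 1}`, as an extended nonnegative real. -/
def diamondNorm (T : Superop ι) : ℝ≥0∞ :=
  ⨆ (n : ℕ) (X : Matrix (ι × Fin n) (ι × Fin n) ℂ) (_ : X ≠ 0),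
    ENNReal.ofReal (traceNorm (ampliate T n X)) / ENNReal.ofReal (traceNorm X)

/-- A state (density matrix). -/
def IsState (ρ : Matrix ι ι ℂ) : Prop := ρ.PosSemidef ∧ ρ.trace = 1

/-- Superoperators in Lindblad form:
`ρ ↦ i[ρ, H] + ∑_j (L_j ρ L_j† - ½ {L_j† L_j, ρ})` with `H` Hermitian. -/
def IsLindbladian (T : Superop ι) : Prop :=
  ∃ (H : Matrix ι ι ℂ) (k : ℕ) (L : Fin k → Matrix ι ι ℂ), H.IsHermitian ∧
    ∀ ρ, T ρ = Complex.I • (ρ * H - H * ρ) +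
      ∑ j, (L j * ρ * (L j)ᴴ - (1 / 2 : ℂ) • ((L j)ᴴ * L j * ρ + ρ * ((L j)ᴴ * L j)))

/-- The evolution `T_t = exp(t 𝓛)` generated by `𝓛`, applied to `ρ`: the sum of the (always
convergent) exponential series `∑_n t^n/n! 𝓛^n ρ`. -/
def evolution (𝓛 : Superop ι) (t : ℝ) (ρ : Matrix ι ι ℂ) : Matrix ι ι ℂ :=
  ∑' n : ℕ, ((t : ℂ) ^ n / (n.factorial : ℂ)) • (𝓛 ^ n) ρ

end Norms

/-! ### The lattice `ℤ^D` -/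

/-- The sites of the lattice `ℤ^D`. -/
abbrev Site (D : ℕ) : Type := Fin D → ℤ

/-- The graph metric of the square lattice `ℤ^D`: the number of unit steps between two sites. -/
def siteDist {D : ℕ} (x y : Site D) : ℕ := ∑ i, (x i - y i).natAbs

/-- The ball `b_u(r)`. -/
def ball {D : ℕ} (u : Site D) (r : ℕ) : Finset (Site D) :=
  {y ∈ Finset.Icc (fun i => u i - r) (fun i => u i + r) | siteDist u y ≤ r}

theorem mem_ball {D : ℕ} {u y : Site D} {r : ℕ} : y ∈ ball u r ↔ siteDist u y ≤ r := by
  unfold ball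
  rw [Finset.mem_filter, and_iff_right_iff_imp, Finset.mem_Icc]
  intro h
  have key : ∀ i, (u i - y i).natAbs ≤ r := fun i =>
    (Finset.single_le_sum (f := fun i => (u i - y i).natAbs) (fun _ _ => Nat.zero_le _)
      (Finset.mem_univ i)).trans h
  constructor <;> intro i <;> have := key i <;> simp only <;> omega

/-- The diameter of a finite set of sites. -/
def diam {D : ℕ} (Z : Finset (Site D)) : ℕ := (Z ×ˢ Z).sup fun p => siteDist p.1 p.2

open Classical in
/-- `∂_d Λ = {x ∈ Λ | dist(x, Λᶜ) ≤ d}`. -/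
def bdry {D : ℕ} (d : ℕ) (Λ : Finset (Site D)) : Finset (Site D) :=
  {x ∈ Λ | ∃ y, y ∉ Λ ∧ siteDist x y ≤ d}

theorem bdry_subset {D : ℕ} (d : ℕ) (Λ : Finset (Site D)) : bdry d Λ ⊆ Λ := by
  classical
  exact Finset.filter_subset _ _

/-- The union of a finite collection of balls, each given by its centre and radius. -/
def region {D : ℕ} (𝓒 : Finset (Site D × ℕ)) : Finset (Site D) := 𝓒.biUnion fun c => ball c.1 c.2

theorem ball_subset_region {D : ℕ} {𝓒 : Finset (Site D × ℕ)} {c : Site D × ℕ} (hc : c ∈ 𝓒) :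
    ball c.1 c.2 ⊆ region 𝓒 :=
  Finset.subset_biUnion_of_mem (fun c : Site D × ℕ => ball c.1 c.2) hc

/-- The union of the balls in `𝓒` is a disjoint union in the lattice graph: different balls
neither meet nor touch, so that the balls are the connected components of `region 𝓒`. -/
def IsDisjointUnion {D : ℕ} (𝓒 : Finset (Site D × ℕ)) : Prop :=
  ∀ c ∈ 𝓒, ∀ c' ∈ 𝓒, c ≠ c' → ∀ x ∈ ball c.1 c.2, ∀ y ∈ ball c'.1 c'.2, 1 < siteDist x y

/-- `{x | dist(x, A) ≤ s}`. -/
def nbhd {D : ℕ} (A : Finset (Site D)) (s : ℕ) : Finset (Site D) := A.biUnion fun a => ball a s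

/-- `region 𝓒` is `A(s)`: a smallest disjoint union of balls that contains
`{x | dist(x, A) ≤ s}`. -/
def IsHull {D : ℕ} (A : Finset (Site D)) (s : ℕ) (𝓒 : Finset (Site D × ℕ)) : Prop :=
  IsDisjointUnion 𝓒 ∧ nbhd A s ⊆ region 𝓒 ∧
    ∀ 𝓒' : Finset (Site D × ℕ), IsDisjointUnion 𝓒' → nbhd A s ⊆ region 𝓒' →
      (region 𝓒).card ≤ (region 𝓒').card

/-! ### Local operators

The site `x` carries the Hilbert space `ℂ^(q x)`. -/

/-- The labels of the product basis of `𝓗_Λ = ⊗_{x ∈ Λ} ℂ^(q x)`. -/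
abbrev Cfg {D : ℕ} (q : Site D → ℕ) (Λ : Finset (Site D)) : Type := (x : Λ) → Fin (q x)

/-- The operators on `𝓗_Λ`. -/
abbrev Op {D : ℕ} (q : Site D → ℕ) (Λ : Finset (Site D)) : Type :=
  Matrix (Cfg q Λ) (Cfg q Λ) ℂ

section Local

variable {D : ℕ} {q : Site D → ℕ} {Z Λ : Finset (Site D)}

/-- Restriction of a basis label from `Λ` to `Z ⊆ Λ`. -/
def restrict (h : Z ⊆ Λ) (σ : Cfg q Λ) : Cfg q Z := fun x => σ ⟨x.1, h x.2⟩

/-- Replacement of the part of `σ` in `Z` by `a`. -/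
def replace (σ : Cfg q Λ) (a : Cfg q Z) : Cfg q Λ := fun x =>
  if hx : x.1 ∈ Z then a ⟨x.1, hx⟩ else σ x

/-- The superoperator `T ⊗ id` on `𝓐_Λ = 𝓐_Z ⊗ 𝓐_{Λ ∖ Z}`, for `T` on `𝓐_Z`. -/
def extend (h : Z ⊆ Λ) (T : Superop (Cfg q Z)) : Superop (Cfg q Λ) where
  toFun X := Matrix.of fun σ σ' =>
    T (Matrix.of fun a b => X (replace σ a) (replace σ' b)) (restrict h σ) (restrict h σ')
  map_add' X Y := by
    ext σ σ'
    exact congrFun (congrFun (map_add T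
      (Matrix.of fun a b => X (replace σ a) (replace σ' b))
      (Matrix.of fun a b => Y (replace σ a) (replace σ' b))) _) _
  map_smul' c X := by
    ext σ σ'
    exact congrFun (congrFun (map_smul T c
      (Matrix.of fun a b => X (replace σ a) (replace σ' b))) _) _

/-- The product `ρ ⊗ τ` on `Λ` of an operator on `Z ⊆ Λ` and an operator on `Λ ∖ Z`. -/
def tensor (h : Z ⊆ Λ) (ρ : Op q Z) (τ : Op q (Λ \ Z)) : Op q Λ :=
  Matrix.of fun σ σ' => ρ (restrict h σ) (restrict h σ') *
    τ (restrict Finset.sdiff_subset σ) (restrict Finset.sdiff_subset σ')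

end Local

/-! ### Uniform families -/

/-- A uniform family of Lindbladians on `ℤ^D`: local terms `𝓜_Z`, supported on the finite sets
`Z ⊂ ℤ^D`, and for each ball `b_u(N)` a boundary condition with terms `𝓑_d`, `d ≥ 1`, supported on
`∂_d b_u(N)`. As `∂_d b_u(N) = b_u(N)` for `d ≥ N + 1`, the terms beyond `N` can be
collected in `𝓑_{N+1}`; only the values `1 ≤ d ≤ N + 1` are used. -/
structure UniformFamily (D : ℕ) (q : Site D → ℕ) where
  bulk : (Z : Finset (Site D)) → Superop (Cfg q Z)
  bulk_lindbladian : ∀ Z, IsLindbladian (bulk Z)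
  bd : (u : Site D) → (N d : ℕ) → Superop (Cfg q (bdry d (ball u N)))
  bd_lindbladian : ∀ u N d, IsLindbladian (bd u N d)

namespace UniformFamily

variable {D : ℕ} {q : Site D → ℕ} (F : UniformFamily D q)

/-- `∑_{Z ⊆ W} 𝓜_Z`, acting on `𝓐_Λ`, for `W ⊆ Λ`. -/
def bulkGen {W Λ : Finset (Site D)} (h : W ⊆ Λ) : Superop (Cfg q Λ) :=
  ∑ Z : W.powerset, extend ((Finset.mem_powerset.1 Z.2).trans h) (F.bulk Z)

/-- `𝓑_d^{∂b}` for the component `b = b_u(N)` of `Λ = region 𝓒`, acting on `𝓐_Λ`. -/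
def bdTerm {𝓒 : Finset (Site D × ℕ)} (c : 𝓒) (d : ℕ) : Superop (Cfg q (region 𝓒)) :=
  extend ((bdry_subset d _).trans (ball_subset_region c.2)) (F.bd c.1.1 c.1.2 d)

/-- The closed boundary generator `𝓛^{Λ̄} = ∑_{Z ⊆ Λ} 𝓜_Z + ∑_d 𝓑_d^{∂Λ}` of `Λ = region 𝓒`, with
the boundary conditions of all components of `Λ`. -/
def closedGen (𝓒 : Finset (Site D × ℕ)) : Superop (Cfg q (region 𝓒)) :=
  F.bulkGen (Finset.Subset.refl (region 𝓒)) +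
    ∑ c : 𝓒, ∑ d ∈ Finset.Icc 1 (c.1.2 + 1), F.bdTerm c d

/-- `𝓛^{B̄ ∖ A} = ∑_{Z ⊆ B ∖ A} 𝓜_Z + ∑_{d ≤ k} 𝓑_d^{∂B}` on `B = region 𝓒`. -/
def cutGen (𝓒 : Finset (Site D × ℕ)) (A : Finset (Site D)) (k : ℕ) :
    Superop (Cfg q (region 𝓒)) :=
  F.bulkGen (W := region 𝓒 \ A) Finset.sdiff_subset +
    ∑ c : 𝓒, ∑ d ∈ Finset.Icc 1 (c.1.2 + 1) with d ≤ k, F.bdTerm c d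

/-- `ρ` is a fixed state of the evolution with closed boundary on `region 𝓒`. -/
def IsFixedState (𝓒 : Finset (Site D × ℕ)) (ρ : Op q (region 𝓒)) : Prop :=
  IsState ρ ∧ ∀ t : ℝ, 0 ≤ t → evolution (F.closedGen 𝓒) t ρ = ρ

/-- Frustration freeness: all local terms inside `Λ` annihilate every fixed state of the closed
boundary evolution on `Λ`, for all disjoint unions `Λ` of balls. -/
def FrustrationFree : Prop :=
  ∀ 𝓒 : Finset (Site D × ℕ), IsDisjointUnion 𝓒 → ∀ ρ : Op q (region 𝓒), F.IsFixedState 𝓒 ρ →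
    ∀ (Z : Finset (Site D)) (hZ : Z ⊆ region 𝓒), extend hZ (F.bulk Z) ρ = 0

/-- The Lieb-Robinson assumptions, with growth function `ν` and velocity `v`. -/
structure LiebRobinson (ν : ℕ → ℝ) (v : ℝ) : Prop where
  nonneg : 0 ≤ v
  pos : ∀ r, 0 < ν r
  mono : Monotone ν
  submul : ∀ r s, ν (r + s) ≤ ν r * ν s
  /-- `sup_x ∑_{Z ∋ x} ‖𝓜_Z‖_⋄ |Z| ν(diam Z) ≤ v` -/
  bulk_decay : ∀ x : Site D,
    ∑' Z : {Z : Finset (Site D) // x ∈ Z},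
      diamondNorm (F.bulk Z) * (Z.1.card : ℝ≥0∞) * ENNReal.ofReal (ν (diam Z.1)) ≤
        ENNReal.ofReal v
  /-- `sup_x sup_r ν(r) ∑_{d ≥ r} ‖𝓑_d^{∂b_x(N)}‖_⋄ ≤ poly(N)` -/
  bd_decay : ∃ P : Polynomial ℝ, ∀ (x : Site D) (N r : ℕ), 1 ≤ r →
    ENNReal.ofReal (ν r) * ∑ d ∈ Finset.Icc r (N + 1), diamondNorm (F.bd x N d) ≤
      ENNReal.ofReal (P.eval (N : ℝ))

end UniformFamily

end

end OpenLattice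

open OpenLattice

namespace OpenLattice

/-! Put `σ = ρ ⊗ τ` and let `u(s)` be the evolution of `σ` under the cut generator. The difference
`x` of the two evolutions starts at `0` and solves `x' = 𝓛 x + w`, where `𝓛` is the closed generator
and `w` is the difference of the two generators applied to `u`. Since `𝓛` generates trace norm
contractions, `‖x(t)‖₁ ≤ ∫₀ᵗ ‖w‖₁` (`traceNorm_le_of_hasDerivAt`). The boundary terms in `w` have `d
> m + 1` and are of order `poly(m) / ν(m)` by hypothesis. What remains are the `𝓜_Z u` with `Z`
meeting `A`.

At time `0` frustration freeness on `A(m)` gives `𝓜_Z σ = 0` for `Z ⊆ A(m)`. This persists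
approximately: `𝓜_Z` commutes with every generator term supported off `Z`, so `‖𝓜_Z u‖₁` grows only
through terms that meet `Z`, hence through other `‖𝓜_Z' u‖₁` and the boundary terms
(`bulkNorm_le_integral`). These integral inequalities close once the norms at a site `x` are
weighted by `ν(δ x)`, with `δ x` the depth of `x` in the `m`-neighbourhood of `A`. As `δ` is
1-Lipschitz and `ν` submultiplicative, `ν(δ x) ≤ ν(diam Z) ν(δ y)` for `x, y ∈ Z`, so the bulk
hypothesis gives growth rate `v`; the support of a boundary term `𝓑_d` has depth at most `d`, so it
costs at most `ν(d) ‖𝓑_d‖`. Grönwall (`LiebRobinson.siteNorm_le`) then bounds the terms at a site of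
`A` by `poly(m) e^{vs} / ν(m)`, and integration in `s` finishes.

Only Hermitian matrices occur. Their trace norm is handled through differences of positive matrices,
and contractivity through a first order condition on the generator that is stable under sums
(`IsDissipative`). -/

theorem isHermitian_real_smul {ι : Type} {X : Matrix ι ι ℂ} (hX : X.IsHermitian) (c : ℝ) :
    (c • X).IsHermitian := by
  rw [Matrix.IsHermitian, Matrix.conjTranspose_smul, hX.eq, star_trivial]

theorem isHermitian_sum {ι : Type} {α : Type*} (s : Finset α) {f : α → Matrix ι ι ℂ}
    (hf : ∀ a ∈ s, (f a).IsHermitian) : (∑ a ∈ s, f a).IsHermitian := by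
  rw [Matrix.IsHermitian, Matrix.conjTranspose_sum]
  exact Finset.sum_congr rfl fun a ha => (hf a ha).eq

/-! ### The trace norm on Hermitian matrices -/

section TraceNorm

variable {ι κ : Type} [Fintype ι] [DecidableEq ι] [Fintype κ] [DecidableEq κ]

/-- A characteristic polynomial is insensitive to reindexing and to unitary conjugation, which an
ordered list of eigenvalues does not show. -/
theorem traceNorm_eq_roots (X : Matrix ι ι ℂ) :
    traceNorm X = ((Xᴴ * X).charpoly.roots.map fun z => Real.sqrt z.re).sum := by
  rw [(Matrix.isHermitian_conjTranspose_mul_self X).roots_charpoly_eq_eigenvalues, Multiset.map_map]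
  rfl

theorem traceNorm_submatrix_equiv (e : κ ≃ ι) (X : Matrix ι ι ℂ) :
    traceNorm (X.submatrix e e) = traceNorm X := by
  rw [traceNorm_eq_roots, traceNorm_eq_roots]
  have h : (X.submatrix e e)ᴴ * X.submatrix e e = Matrix.reindex e.symm e.symm (Xᴴ * X) := by
    rw [Matrix.conjTranspose_submatrix, Matrix.submatrix_mul_equiv]
    rfl
  rw [h, Matrix.charpoly_reindex]

theorem traceNorm_nonneg (X : Matrix ι ι ℂ) : 0 ≤ traceNorm X :=
  Finset.sum_nonneg fun _ _ => Real.sqrt_nonneg _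

/-- Spectral decomposition, with the unitary given as a matrix. -/
theorem exists_unitary_diagonal {X : Matrix ι ι ℂ} (hX : X.IsHermitian) :
    ∃ (U : Matrix ι ι ℂ) (l : ι → ℝ), Uᴴ * U = 1 ∧ U * Uᴴ = 1 ∧
      X = U * Matrix.diagonal (fun i => (l i : ℂ)) * Uᴴ ∧ traceNorm X = ∑ i, |l i| := by
  have h1 : (hX.eigenvectorUnitary : Matrix ι ι ℂ)ᴴ * hX.eigenvectorUnitary = 1 :=
    Unitary.coe_star_mul_self hX.eigenvectorUnitary
  have h2 : (hX.eigenvectorUnitary : Matrix ι ι ℂ) * (hX.eigenvectorUnitary : Matrix ι ι ℂ)ᴴ = 1 :=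
    Unitary.coe_mul_star_self hX.eigenvectorUnitary
  have h3 : X = (hX.eigenvectorUnitary : Matrix ι ι ℂ) *
      Matrix.diagonal (fun i => (hX.eigenvalues i : ℂ)) *
        (hX.eigenvectorUnitary : Matrix ι ι ℂ)ᴴ := by
    conv_lhs => rw [hX.spectral_theorem, Unitary.conjStarAlgAut_apply]
    rfl
  refine ⟨hX.eigenvectorUnitary, hX.eigenvalues, h1, h2, h3, ?_⟩
  generalize (hX.eigenvectorUnitary : Matrix ι ι ℂ) = U at h1 h2 h3
  generalize hX.eigenvalues = l at h3
  have h4 : Xᴴ * X = U * Matrix.diagonal (fun i => ((l i ^ 2 : ℝ) : ℂ)) * Uᴴ := by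
    rw [hX.eq, h3]
    calc _ = U * Matrix.diagonal (fun i => (l i : ℂ)) * (Uᴴ * U) *
          Matrix.diagonal (fun i => (l i : ℂ)) * Uᴴ := by simp only [Matrix.mul_assoc]
      _ = _ := by
        rw [h1, Matrix.mul_one, Matrix.mul_assoc U, Matrix.diagonal_mul_diagonal]
        simp [sq]
  rw [traceNorm_eq_roots, h4, Matrix.charpoly_mul_comm, ← Matrix.mul_assoc, h1, Matrix.one_mul,
    Matrix.charpoly_diagonal, Polynomial.roots_prod]
  · simp only [Polynomial.roots_X_sub_C, Multiset.bind_singleton, Multiset.map_map,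
      Function.comp_apply, Complex.ofReal_re, Real.sqrt_sq_eq_abs]
    rfl
  · exact Finset.prod_ne_zero_iff.2 fun i _ => Polynomial.X_sub_C_ne_zero _

/-- In an eigenbasis of `P - Q` each eigenvalue is a difference of nonnegative diagonal entries of
`P` and `Q`, so its modulus is at most their sum. With `exists_sub_posSemidef` this makes `‖X‖₁` the
minimum of `tr P + tr Q` over `X = P - Q`, whence the triangle inequality. -/
theorem traceNorm_sub_le {P Q : Matrix ι ι ℂ} (hP : P.PosSemidef) (hQ : Q.PosSemidef) :
    traceNorm (P - Q) ≤ P.trace.re + Q.trace.re := by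
  obtain ⟨U, l, h1, h2, h3, h4⟩ := exists_unitary_diagonal (hP.1.sub hQ.1)
  have tr : ∀ M : Matrix ι ι ℂ, M.trace.re = ∑ i, ((Uᴴ * M * U) i i).re := fun M => by
    rw [← Complex.re_sum]
    change _ = (Uᴴ * M * U).trace.re
    rw [Matrix.trace_mul_comm, ← Matrix.mul_assoc, h2, Matrix.one_mul]
  have hl : ∀ i, l i = ((Uᴴ * P * U) i i).re - ((Uᴴ * Q * U) i i).re := fun i => by
    have h5 : Uᴴ * P * U - Uᴴ * Q * U = Matrix.diagonal (fun i => (l i : ℂ)) := by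
      rw [← Matrix.sub_mul, ← Matrix.mul_sub, h3]
      calc _ = (Uᴴ * U) * Matrix.diagonal (fun i => (l i : ℂ)) * (Uᴴ * U) := by
            simp only [Matrix.mul_assoc]
        _ = _ := by simp [h1]
    have := congrArg Complex.re (congrFun (congrFun h5 i) i)
    simpa using this.symm
  rw [h4, tr P, tr Q, ← Finset.sum_add_distrib]
  refine Finset.sum_le_sum fun i _ => ?_
  have hp : 0 ≤ ((Uᴴ * P * U) i i).re :=
    (Complex.nonneg_iff.1 ((hP.conjTranspose_mul_mul_same U).diag_nonneg (i := i))).1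
  have hq : 0 ≤ ((Uᴴ * Q * U) i i).re :=
    (Complex.nonneg_iff.1 ((hQ.conjTranspose_mul_mul_same U).diag_nonneg (i := i))).1
  rw [hl i, abs_le]
  constructor <;> linarith

theorem exists_sub_posSemidef {X : Matrix ι ι ℂ} (hX : X.IsHermitian) :
    ∃ P Q : Matrix ι ι ℂ, P.PosSemidef ∧ Q.PosSemidef ∧ X = P - Q ∧
      traceNorm X = P.trace.re + Q.trace.re := by
  obtain ⟨U, l, h1, h2, h3, h4⟩ := exists_unitary_diagonal hX
  have pos : ∀ w : ι → ℝ, (∀ i, 0 ≤ w i) →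
      (U * Matrix.diagonal (fun i => (w i : ℂ)) * Uᴴ).PosSemidef := fun w hw =>
    (Matrix.PosSemidef.diagonal fun i => by simpa using hw i).mul_mul_conjTranspose_same U
  have tr : ∀ w : ι → ℝ, (U * Matrix.diagonal (fun i => (w i : ℂ)) * Uᴴ).trace.re = ∑ i, w i :=
    fun w => by
      rw [Matrix.trace_mul_comm, ← Matrix.mul_assoc, h1, Matrix.one_mul, Matrix.trace_diagonal]
      simp
  refine ⟨_, _, pos (fun i => max (l i) 0) fun i => le_max_right _ _,
    pos (fun i => max (-l i) 0) fun i => le_max_right _ _, ?_, ?_⟩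
  · rw [← Matrix.sub_mul, ← Matrix.mul_sub, Matrix.diagonal_sub]
    convert! h3 using 5 with i
    rw [← Complex.ofReal_sub, max_zero_sub_eq_self]
  · rw [tr, tr, h4, ← Finset.sum_add_distrib]
    refine Finset.sum_congr rfl fun i _ => ?_
    rcases le_total 0 (l i) with h | h <;> simp [h, abs_of_nonneg, abs_of_nonpos]

theorem traceNorm_add_le {X Y : Matrix ι ι ℂ} (hX : X.IsHermitian) (hY : Y.IsHermitian) :
    traceNorm (X + Y) ≤ traceNorm X + traceNorm Y := by
  obtain ⟨P, Q, hP, hQ, rfl, h⟩ := exists_sub_posSemidef hX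
  obtain ⟨P', Q', hP', hQ', rfl, h'⟩ := exists_sub_posSemidef hY
  have := traceNorm_sub_le (hP.add hP') (hQ.add hQ')
  rw [Matrix.trace_add, Matrix.trace_add, Complex.add_re, Complex.add_re] at this
  rw [h, h', show P - Q + (P' - Q') = P + P' - (Q + Q') by abel]
  linarith

theorem traceNorm_of_posSemidef {X : Matrix ι ι ℂ} (hX : X.PosSemidef) :
    traceNorm X = X.trace.re := by
  refine le_antisymm ?_ ?_
  · simpa using traceNorm_sub_le hX Matrix.PosSemidef.zero
  · obtain ⟨P, Q, hP, hQ, e, h⟩ := exists_sub_posSemidef hX.1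
    have := (Complex.nonneg_iff.1 hQ.trace_nonneg).1
    rw [h, e, Matrix.trace_sub, Complex.sub_re]
    linarith

theorem traceNorm_zero : traceNorm (0 : Matrix ι ι ℂ) = 0 := by
  simp [traceNorm_of_posSemidef Matrix.PosSemidef.zero]

theorem traceNorm_smul_le {X : Matrix ι ι ℂ} (hX : X.IsHermitian) {c : ℝ} (hc : 0 ≤ c) :
    traceNorm (c • X) ≤ c * traceNorm X := by
  obtain ⟨P, Q, hP, hQ, rfl, h⟩ := exists_sub_posSemidef hX
  have := traceNorm_sub_le (hP.smul hc) (hQ.smul hc)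
  rw [smul_sub, h]
  simpa [Matrix.trace_smul, mul_add] using this

theorem traceNorm_neg {X : Matrix ι ι ℂ} : traceNorm (-X) = traceNorm X := by
  simp [traceNorm_eq_roots]

theorem traceNorm_sum_le {α : Type*} (s : Finset α) {f : α → Matrix ι ι ℂ}
    (hf : ∀ a ∈ s, (f a).IsHermitian) : traceNorm (∑ a ∈ s, f a) ≤ ∑ a ∈ s, traceNorm (f a) := by
  classical
  induction s using Finset.induction_on with
  | empty => simp [traceNorm_zero]
  | insert a s ha ih =>
    rw [Finset.sum_insert ha, Finset.sum_insert ha]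
    have hs := fun b hb => hf b (Finset.mem_insert_of_mem hb)
    exact (traceNorm_add_le (hf a (Finset.mem_insert_self _ _)) (isHermitian_sum s hs)).trans
      (by gcongr; exact ih hs)

/-- The trace norm is bounded by a multiple of any bound on the entries. -/
theorem traceNorm_le_of_entries {X : Matrix ι ι ℂ} (hX : X.IsHermitian) {b : ℝ}
    (hb : ∀ i j, ‖X i j‖ ≤ b) :
    traceNorm X ≤ (Fintype.card ι : ℝ) * (Fintype.card ι : ℝ) * b := by
  obtain ⟨U, l, h1, h2, h3, h4⟩ := exists_unitary_diagonal hX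
  -- The Hilbert-Schmidt norm, computed from the eigenvalues and from the entries.
  have hsq : ∑ i, l i ^ 2 = ∑ i, ∑ j, ‖X i j‖ ^ 2 := by
    have e1 : (X * Xᴴ).trace = ∑ i, ∑ j, ((‖X i j‖ ^ 2 : ℝ) : ℂ) := by
      simp only [Matrix.trace, Matrix.diag, Matrix.mul_apply, Matrix.conjTranspose_apply]
      refine Finset.sum_congr rfl fun i _ => Finset.sum_congr rfl fun j _ => ?_
      rw [Complex.star_def, Complex.mul_conj, Complex.normSq_eq_norm_sq]
    have e2 : (X * Xᴴ).trace = ∑ i, ((l i ^ 2 : ℝ) : ℂ) := by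
      rw [hX.eq]
      conv_lhs => rw [h3]
      calc _ = (U * (Matrix.diagonal (fun i => (l i : ℂ)) * (Uᴴ * U) *
            Matrix.diagonal (fun i => (l i : ℂ)) * Uᴴ)).trace := by
              simp only [Matrix.mul_assoc]
        _ = _ := by
          rw [h1, Matrix.mul_one, Matrix.trace_mul_comm, Matrix.mul_assoc, h1, Matrix.mul_one,
            Matrix.diagonal_mul_diagonal, Matrix.trace_diagonal]
          simp [sq]
    exact_mod_cast e2.symm.trans e1
  rcases isEmpty_or_nonempty ι with h | ⟨⟨i₀⟩⟩
  · simp [h4]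
  have hb0 : 0 ≤ b := (norm_nonneg _).trans (hb i₀ i₀)
  have hn : (0 : ℝ) ≤ Fintype.card ι := Nat.cast_nonneg _
  have hl : ∀ i, |l i| ≤ Fintype.card ι * b := fun i => by
    refine abs_le_of_sq_le_sq ?_ (by positivity)
    calc l i ^ 2 ≤ ∑ i, l i ^ 2 :=
          Finset.single_le_sum (f := fun i => l i ^ 2) (fun _ _ => sq_nonneg _) (Finset.mem_univ i)
      _ = ∑ i, ∑ j, ‖X i j‖ ^ 2 := hsq
      _ ≤ ∑ i : ι, ∑ j : ι, b ^ 2 := by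
        gcongr with i _ j _
        exact hb i j
      _ = _ := by simp; ring
  rw [h4]
  calc ∑ i, |l i| ≤ ∑ _i : ι, (Fintype.card ι : ℝ) * b := Finset.sum_le_sum fun i _ => hl i
    _ = _ := by simp; ring

end TraceNorm

/-! ### Dissipative generators and their evolutions -/

section Dynamics

open Filter Topology Set

/-- Differentiability of a matrix curve depends only on the topology, so an auxiliary norm may be
chosen inside the proof; likewise below. -/
theorem continuous_of_hasDerivAt {ι : Type} [Fintype ι] {x x' : ℝ → Matrix ι ι ℂ}
    (hx : ∀ t, HasDerivAt x (x' t) t) : Continuous x :=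
  let : NormedAddCommGroup (Matrix ι ι ℂ) := Matrix.normedAddCommGroup
  let : NormedSpace ℝ (Matrix ι ι ℂ) := Matrix.normedSpace
  continuous_iff_continuousAt.2 fun t => (hx t).continuousAt

theorem hasDerivAt_matrix_sub {ι : Type} [Fintype ι] {x y : ℝ → Matrix ι ι ℂ}
    {x' y' : Matrix ι ι ℂ} {t : ℝ} (hx : HasDerivAt x x' t) (hy : HasDerivAt y y' t) :
    HasDerivAt (fun s => x s - y s) (x' - y') t :=
  let : NormedAddCommGroup (Matrix ι ι ℂ) := Matrix.normedAddCommGroup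
  let : NormedSpace ℝ (Matrix ι ι ℂ) := Matrix.normedSpace
  HasDerivAt.fun_sub hx hy

theorem tendsto_slope_of_hasDerivAt {ι : Type} [Fintype ι] {x : ℝ → Matrix ι ι ℂ}
    {x' : Matrix ι ι ℂ} {t : ℝ} (hx : HasDerivAt x x' t) :
    Tendsto (slope x t) (𝓝[≠] t) (𝓝 x') :=
  let : NormedAddCommGroup (Matrix ι ι ℂ) := Matrix.normedAddCommGroup
  let : NormedSpace ℝ (Matrix ι ι ℂ) := Matrix.normedSpace
  hasDerivAt_iff_tendsto_slope.1 hx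

section Dissipative

variable {ι : Type} [Fintype ι] [DecidableEq ι]

/-- `T` preserves Hermitian matrices, and `1 + sT` is contractive on them up to order `s²`. -/
def IsDissipative (T : Superop ι) : Prop :=
  ∀ X : Matrix ι ι ℂ, X.IsHermitian → (T X).IsHermitian ∧
    ∃ C : ℝ, ∀ s : ℝ, 0 ≤ s → traceNorm (X + s • T X) ≤ traceNorm X + C * s ^ 2

/-- A step of length `s` along the sum is the average of two steps of length `2s`, one along each
summand. -/
theorem IsDissipative.add {T T' : Superop ι} (h : IsDissipative T) (h' : IsDissipative T') :
    IsDissipative (T + T') := by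
  intro X hX
  obtain ⟨hT, C, hC⟩ := h X hX
  obtain ⟨hT', C', hC'⟩ := h' X hX
  refine ⟨hT.add hT', 2 * C + 2 * C', fun s hs => ?_⟩
  have e : X + s • (T + T') X =
      (1 / 2 : ℝ) • (X + (2 * s) • T X) + (1 / 2 : ℝ) • (X + (2 * s) • T' X) := by
    rw [LinearMap.add_apply]
    module
  have h1 := hX.add (isHermitian_real_smul hT (2 * s))
  have h2 := hX.add (isHermitian_real_smul hT' (2 * s))
  have := traceNorm_add_le (isHermitian_real_smul h1 (1 / 2)) (isHermitian_real_smul h2 (1 / 2))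
  have := traceNorm_smul_le h1 (c := 1 / 2) (by norm_num)
  have := traceNorm_smul_le h2 (c := 1 / 2) (by norm_num)
  have := hC (2 * s) (by positivity)
  have := hC' (2 * s) (by positivity)
  rw [e]
  linarith

theorem isDissipative_zero : IsDissipative (0 : Superop ι) := fun X _ =>
  ⟨by simp [Matrix.IsHermitian], 0, fun s _ => by simp⟩

theorem isDissipative_sum {α : Type*} (s : Finset α) {T : α → Superop ι}
    (hT : ∀ a ∈ s, IsDissipative (T a)) : IsDissipative (∑ a ∈ s, T a) :=
  Finset.sum_induction _ _ (fun _ _ => IsDissipative.add) isDissipative_zero hT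

/-- With `T X = K X + X Kᴴ + ∑ L X Lᴴ`, the map `X + s T X + s² K X Kᴴ` equals `(1 + sK) X (1 + sK)ᴴ
+ s ∑ L X Lᴴ`, which is positive. As `T` kills traces, it changes the trace only at order `s²`.
Applied to both parts of `X = P - Q` this bounds the trace norm. -/
theorem IsLindbladian.isDissipative {T : Superop ι} (hT : IsLindbladian T) : IsDissipative T := by
  obtain ⟨H, k, L, hH, hL⟩ := hT
  set S := ∑ j, (L j)ᴴ * L j with hS
  set K := -(Complex.I • H) - (1 / 2 : ℂ) • S with hK
  have hSH : Sᴴ = S := (isHermitian_sum _ fun j _ => Matrix.isHermitian_conjTranspose_mul_self (L j)).eq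
  have hKH : Kᴴ = Complex.I • H - (1 / 2 : ℂ) • S := by
    simp [hK, Matrix.conjTranspose_sub, Matrix.conjTranspose_neg, Matrix.conjTranspose_smul, hH.eq,
      hSH]
  have hTK : ∀ X, T X = K * X + X * Kᴴ + ∑ j, L j * X * (L j)ᴴ := fun X => by
    rw [hL, hKH, hK, Finset.sum_sub_distrib, ← Finset.smul_sum, Finset.sum_add_distrib,
      ← Finset.sum_mul, ← Finset.mul_sum, ← hS]
    simp only [Matrix.sub_mul, Matrix.mul_sub, Matrix.neg_mul, Matrix.smul_mul, Matrix.mul_smul]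
    module
  have htr : ∀ X, (T X).trace = 0 := fun X => by
    rw [hL, Matrix.trace_add, Matrix.trace_smul, Matrix.trace_sub, Matrix.trace_mul_comm H,
      Matrix.trace_sum, sub_self, smul_zero, zero_add]
    refine Finset.sum_eq_zero fun j _ => ?_
    rw [Matrix.trace_sub, Matrix.trace_smul, Matrix.trace_add, Matrix.trace_mul_comm X,
      Matrix.trace_mul_cycle]
    simp only [smul_eq_mul]
    ring
  have hherm : ∀ X : Matrix ι ι ℂ, X.IsHermitian → (T X).IsHermitian := fun X hX => by
    rw [hTK]
    refine Matrix.IsHermitian.add ?_ (isHermitian_sum _ fun j _ =>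
      Matrix.isHermitian_mul_mul_conjTranspose _ hX)
    rw [Matrix.IsHermitian, Matrix.conjTranspose_add, Matrix.conjTranspose_mul,
      Matrix.conjTranspose_mul, Matrix.conjTranspose_conjTranspose, hX.eq, add_comm]
  intro X hX
  refine ⟨hherm X hX, ?_⟩
  obtain ⟨P, Q, hP, hQ, rfl, hN⟩ := exists_sub_posSemidef hX
  -- the completely positive map `X + s T X + s² K X Kᴴ`
  have key : ∀ (s : ℝ), 0 ≤ s → ∀ R : Matrix ι ι ℂ, R.PosSemidef →
      (R + s • T R + s ^ 2 • (K * R * Kᴴ)).PosSemidef := fun s hs R hR => by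
    have e : R + s • T R + s ^ 2 • (K * R * Kᴴ) =
        (1 + s • K) * R * (1 + s • K)ᴴ + s • ∑ j, L j * R * (L j)ᴴ := by
      rw [hTK, Matrix.conjTranspose_add, Matrix.conjTranspose_smul, Matrix.conjTranspose_one,
        star_trivial]
      simp only [Matrix.add_mul, Matrix.mul_add, Matrix.one_mul, Matrix.mul_one, Matrix.smul_mul,
        Matrix.mul_smul]
      module
    rw [e]
    exact (hR.mul_mul_conjTranspose_same _).add ((Matrix.posSemidef_sum _ fun j _ =>
      hR.mul_mul_conjTranspose_same (L j)).smul hs)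
  have tr : ∀ (s : ℝ) (R : Matrix ι ι ℂ), (R + s • T R + s ^ 2 • (K * R * Kᴴ)).trace.re =
      R.trace.re + s ^ 2 * (K * R * Kᴴ).trace.re := fun s R => by
    rw [Matrix.trace_add, Matrix.trace_add, Matrix.trace_smul, Matrix.trace_smul, htr, smul_zero,
      add_zero, Complex.add_re, Complex.smul_re, smul_eq_mul]
  refine ⟨2 * ((K * P * Kᴴ).trace.re + (K * Q * Kᴴ).trace.re), fun s hs => ?_⟩
  have h1 := traceNorm_sub_le (key s hs P hP) (key s hs Q hQ)
  rw [tr, tr] at h1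
  have hPQ := Matrix.isHermitian_mul_mul_conjTranspose K (hP.1.sub hQ.1)
  have h2 : traceNorm (K * (P - Q) * Kᴴ) ≤ (K * P * Kᴴ).trace.re + (K * Q * Kᴴ).trace.re := by
    rw [Matrix.mul_sub, Matrix.sub_mul]
    exact traceNorm_sub_le (hP.mul_mul_conjTranspose_same K) (hQ.mul_mul_conjTranspose_same K)
  have h3 := traceNorm_smul_le hPQ (sq_nonneg s)
  have h4 := traceNorm_add_le (X := P - Q + s • T (P - Q) + s ^ 2 • (K * (P - Q) * Kᴴ))
    (((hP.1.sub hQ.1).add (isHermitian_real_smul (hherm _ (hP.1.sub hQ.1)) s)).add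
      (isHermitian_real_smul hPQ _)) (isHermitian_real_smul hPQ (s ^ 2)).neg
  rw [traceNorm_neg, add_neg_cancel_right] at h4
  have e : P - Q + s • T (P - Q) + s ^ 2 • (K * (P - Q) * Kᴴ) =
      P + s • T P + s ^ 2 • (K * P * Kᴴ) - (Q + s • T Q + s ^ 2 • (K * Q * Kᴴ)) := by
    rw [map_sub, Matrix.mul_sub, Matrix.sub_mul]
    module
  rw [e] at h4
  have h5 := mul_le_mul_of_nonneg_left h2 (sq_nonneg s)
  rw [hN]
  linarith

theorem tendsto_traceNorm_zero {α : Type*} {l : Filter α} {f : α → Matrix ι ι ℂ}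
    (hf : ∀ a, (f a).IsHermitian) (h : Tendsto f l (𝓝 0)) :
    Tendsto (fun a => traceNorm (f a)) l (𝓝 0) := by
  have h1 : Tendsto (fun a => (Fintype.card ι : ℝ) * (Fintype.card ι : ℝ) *
      ∑ i, ∑ j, ‖f a i j‖) l (𝓝 0) := by
    have : Tendsto (fun a => (Fintype.card ι : ℝ) * (Fintype.card ι : ℝ) *
        ∑ i, ∑ j, ‖f a i j‖) l (𝓝 ((Fintype.card ι : ℝ) * (Fintype.card ι : ℝ) *
          ∑ i, ∑ j, ‖(0 : Matrix ι ι ℂ) i j‖)) :=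
      (tendsto_finsetSum _ fun i _ => tendsto_finsetSum _ fun j _ =>
        (tendsto_pi_nhds.1 (tendsto_pi_nhds.1 h i) j).norm).const_mul _
    simpa using this
  refine squeeze_zero (fun a => traceNorm_nonneg _) (fun a => ?_) h1
  refine traceNorm_le_of_entries (hf a) fun i j => ?_
  exact (Finset.single_le_sum (f := fun j => ‖f a i j‖) (fun _ _ => norm_nonneg _)
    (Finset.mem_univ j)).trans (Finset.single_le_sum (f := fun i => ∑ j, ‖f a i j‖)
      (fun _ _ => Finset.sum_nonneg fun _ _ => norm_nonneg _) (Finset.mem_univ i))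

theorem continuous_traceNorm {α : Type*} [TopologicalSpace α] {f : α → Matrix ι ι ℂ}
    (hf : ∀ a, (f a).IsHermitian) (h : Continuous f) : Continuous fun a => traceNorm (f a) := by
  refine continuous_iff_continuousAt.2 fun a => ?_
  have h0 : Tendsto (fun b => traceNorm (f b - f a)) (𝓝 a) (𝓝 0) :=
    tendsto_traceNorm_zero (fun b => (hf b).sub (hf a)) (by
      simpa using (h.tendsto a).sub_const (f a))
  rw [ContinuousAt, tendsto_iff_dist_tendsto_zero]
  refine squeeze_zero (fun _ => dist_nonneg) (fun b => ?_) h0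
  have h1 := traceNorm_add_le ((hf b).sub (hf a)) (hf a)
  have h2 := traceNorm_add_le ((hf a).sub (hf b)) (hf b)
  rw [← neg_sub (f b), traceNorm_neg, neg_sub] at h2
  rw [sub_add_cancel] at h1 h2
  rw [Real.dist_eq, abs_le]
  constructor <;> linarith

/-- A solution of `x' = G x + w`, `G` dissipative, grows at most at the rate `‖w‖₁`. -/
theorem traceNorm_le_of_hasDerivAt {G : Superop ι} (hG : IsDissipative G)
    {x w : ℝ → Matrix ι ι ℂ} {B b : ℝ → ℝ} (hx : ∀ t, HasDerivAt x (G (x t) + w t) t)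
    (hxH : ∀ t, (x t).IsHermitian) (hwH : ∀ t, (w t).IsHermitian)
    (hB : ∀ t, HasDerivAt B (b t) t) (hw : ∀ t, 0 ≤ t → traceNorm (w t) ≤ b t)
    (h0 : traceNorm (x 0) ≤ B 0) {t : ℝ} (ht : 0 ≤ t) : traceNorm (x t) ≤ B t := by
  have hxc : Continuous x := continuous_of_hasDerivAt hx
  have hBc : Continuous B := continuous_iff_continuousAt.2 fun t => (hB t).continuousAt
  -- The trace norm need not be differentiable along `x`, so only upper bounds on its right slopes
  -- are used.
  refine image_le_of_liminf_slope_right_le_deriv_boundary (f := fun t => traceNorm (x t))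
    (a := 0) (b := t) (B := B) (B' := b) (continuous_traceNorm hxH hxc).continuousOn h0
    hBc.continuousOn (fun s _ => (hB s).hasDerivWithinAt) ?_ (right_mem_Icc.2 ht)
  intro s hs r hr
  obtain ⟨hGH, C, hC⟩ := hG (x s) (hxH s)
  have heH : ∀ z, (slope x s z - (G (x s) + w s)).IsHermitian := fun z => by
    rw [slope_def_module]
    exact (isHermitian_real_smul ((hxH z).sub (hxH s)) _).sub (hGH.add (hwH s))
  have he : Tendsto (fun z => traceNorm (slope x s z - (G (x s) + w s))) (𝓝[>] s) (𝓝 0) := by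
    refine tendsto_traceNorm_zero heH ?_
    have : Tendsto (slope x s) (𝓝[>] s) (𝓝 (G (x s) + w s)) :=
      (tendsto_slope_of_hasDerivAt (hx s)).mono_left (nhdsWithin_mono s fun z hz => ne_of_gt hz)
    simpa using this.sub_const (G (x s) + w s)
  have hlim : Tendsto (fun z => C * (z - s) + traceNorm (w s) +
      traceNorm (slope x s z - (G (x s) + w s))) (𝓝[>] s) (𝓝 (traceNorm (w s))) := by
    have h1 : Tendsto (fun z => C * (z - s)) (𝓝[>] s) (𝓝 0) := by
      have : Tendsto (fun z => C * (z - s)) (𝓝 s) (𝓝 (C * (s - s))) :=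
        Continuous.tendsto (by fun_prop) s
      simpa using this.mono_left nhdsWithin_le_nhds
    simpa using (h1.add_const (traceNorm (w s))).add he
  refine Eventually.frequently ?_
  filter_upwards [hlim.eventually (gt_mem_nhds ((hw s hs.1).trans_lt hr)), self_mem_nhdsWithin]
    with z hz hsz
  have hsz' : 0 < z - s := sub_pos.2 hsz
  refine lt_of_le_of_lt ?_ hz
  -- An Euler step along `G`, the inhomogeneity, and an error that is `o(z - s)`.
  have e : x z = (x s + (z - s) • G (x s)) + ((z - s) • w s +
      (z - s) • (slope x s z - (G (x s) + w s))) := by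
    have : (z - s) • slope x s z = x z - x s := by
      rw [slope_def_module, smul_smul, mul_inv_cancel₀ hsz'.ne', one_smul]
    rw [smul_sub, this]
    module
  have a1 := isHermitian_real_smul (hwH s) (z - s)
  have a2 := isHermitian_real_smul (heH z) (z - s)
  have b1 := traceNorm_add_le ((hxH s).add (isHermitian_real_smul hGH (z - s))) (a1.add a2)
  rw [← e] at b1
  have b2 := traceNorm_add_le a1 a2
  have b3 := traceNorm_smul_le (hwH s) hsz'.le
  have b4 := traceNorm_smul_le (heH z) hsz'.le
  have b5 := hC (z - s) hsz'.le
  rw [slope_def_field, div_le_iff₀ hsz']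
  linarith

end Dissipative

/-- The exponential series of `tT` applied to `ρ` solves `u' = T u`. -/
theorem hasDerivAt_exp_series {E : Type} [NormedAddCommGroup E] [NormedSpace ℂ E] [NormedSpace ℝ E]
    [IsScalarTower ℝ ℂ E] [FiniteDimensional ℂ E] (T : E →ₗ[ℂ] E) (ρ : E) (t : ℝ) :
    HasDerivAt (fun s : ℝ => ∑' n : ℕ, ((s : ℂ) ^ n / (n.factorial : ℂ)) • (T ^ n) ρ)
      (T (∑' n : ℕ, ((t : ℂ) ^ n / (n.factorial : ℂ)) • (T ^ n) ρ)) t := by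
  have : CompleteSpace E := FiniteDimensional.complete ℂ E
  let Tc : E →L[ℂ] E := LinearMap.toContinuousLinearMap T
  have hpow : ∀ (n : ℕ) (X : E), (Tc ^ n) X = (T ^ n) X := by
    intro n
    induction n with
    | zero => intro X; rfl
    | succ n ih =>
      intro X
      rw [pow_succ, pow_succ]
      exact ih _
  have hev : ∀ s : ℝ, ∑' n : ℕ, ((s : ℂ) ^ n / (n.factorial : ℂ)) • (T ^ n) ρ =
      NormedSpace.exp ((s : ℂ) • Tc) ρ := fun s => by
    have hs := NormedSpace.exp_series_hasSum_exp' (𝕂 := ℂ) ((s : ℂ) • Tc)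
    have := (hs.mapL (ContinuousLinearMap.apply ℂ E ρ)).tsum_eq
    rw [ContinuousLinearMap.apply_apply] at this
    rw [← this]
    refine tsum_congr fun n => ?_
    simp only [ContinuousLinearMap.apply_apply, smul_pow, smul_apply,
      smul_smul, hpow]
    congr 1
    field_simp
  have hd := (hasDerivAt_exp_smul_const' Tc (t : ℂ)).scomp t Complex.ofRealCLM.hasDerivAt
  have := ((ContinuousLinearMap.apply ℂ E ρ).restrictScalars ℝ).hasFDerivAt
    |>.comp_hasDerivAt t hd
  simp only [Function.comp_def, ContinuousLinearMap.coe_restrictScalars', Complex.ofRealCLM_apply,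
    Complex.ofReal_one, one_smul, ContinuousLinearMap.apply_apply] at this
  simp only [hev]
  exact this

theorem hasDerivAt_superop {ι : Type} [Fintype ι] (T : Superop ι) {x : ℝ → Matrix ι ι ℂ} {x' : Matrix ι ι ℂ} {t : ℝ}
    (hx : HasDerivAt x x' t) : HasDerivAt (fun s => T (x s)) (T x') t := by
  let : NormedAddCommGroup (Matrix ι ι ℂ) := Matrix.normedAddCommGroup
  let : NormedSpace ℂ (Matrix ι ι ℂ) := Matrix.normedSpace
  let : NormedSpace ℝ (Matrix ι ι ℂ) := Matrix.normedSpace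
  exact ((T.restrictScalars ℝ).toContinuousLinearMap.hasFDerivAt (x := x t)).comp_hasDerivAt t hx

theorem hasDerivAt_evolution {ι : Type} [Fintype ι] (T : Superop ι) (ρ : Matrix ι ι ℂ) (t : ℝ) :
    HasDerivAt (fun s => evolution T s ρ) (T (evolution T t ρ)) t :=
  let : NormedAddCommGroup (Matrix ι ι ℂ) := Matrix.normedAddCommGroup
  let : NormedSpace ℂ (Matrix ι ι ℂ) := Matrix.normedSpace
  let : NormedSpace ℝ (Matrix ι ι ℂ) := Matrix.normedSpace
  hasDerivAt_exp_series T ρ t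

theorem evolution_zero {ι : Type} (T : Superop ι) (ρ : Matrix ι ι ℂ) : evolution T 0 ρ = ρ := by
  rw [evolution, tsum_eq_single 0]
  · simp
  · intro n hn
    simp [hn]

section Evolution

variable {ι : Type} [Fintype ι] [DecidableEq ι]

theorem evolution_isHermitian {T : Superop ι} (hT : IsDissipative T) {ρ : Matrix ι ι ℂ}
    (hρ : ρ.IsHermitian) (t : ℝ) : (evolution T t ρ).IsHermitian := by
  rw [Matrix.IsHermitian, evolution, Matrix.conjTranspose_tsum]
  refine tsum_congr fun n => ?_
  have h : ((T ^ n) ρ).IsHermitian := by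
    induction n with
    | zero => exact hρ
    | succ n ih => rw [pow_succ']; exact (hT _ ih).1
  rw [Matrix.conjTranspose_smul, h.eq]
  simp

/-- Growth of `M u` along `u' = (G₁ + G₂) u` when `M` commutes with `G₁`. -/
theorem traceNorm_apply_le_integral {G₁ G₂ M : Superop ι} (hG₁ : IsDissipative G₁)
    (hG₂ : IsDissipative G₂) (hM : IsDissipative M) (hcomm : ∀ X, M (G₁ X) = G₁ (M X))
    {u : ℝ → Matrix ι ι ℂ} (hu : ∀ t, HasDerivAt u ((G₁ + G₂) (u t)) t)
    (huH : ∀ t, (u t).IsHermitian) {c : ℝ} (hc : 0 ≤ c)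
    (hMc : ∀ X : Matrix ι ι ℂ, X.IsHermitian → traceNorm (M X) ≤ c * traceNorm X)
    {φ : ℝ → ℝ} (hφ : Continuous φ) (hφu : ∀ t, 0 ≤ t → traceNorm (G₂ (u t)) ≤ φ t)
    {t : ℝ} (ht : 0 ≤ t) :
    traceNorm (M (u t)) ≤ traceNorm (M (u 0)) + c * ∫ s in (0 : ℝ)..t, φ s := by
  refine traceNorm_le_of_hasDerivAt hG₁ (x := fun s => M (u s)) (w := fun s => M (G₂ (u s)))
    (B := fun t => traceNorm (M (u 0)) + c * ∫ s in (0 : ℝ)..t, φ s) (b := fun s => c * φ s)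
    (fun s => ?_) (fun s => (hM _ (huH s)).1) (fun s => (hM _ (hG₂ _ (huH s)).1).1) (fun s => ?_)
    (fun s hs => ?_) (by simp) ht
  · rw [← hcomm, ← map_add, ← LinearMap.add_apply]
    exact hasDerivAt_superop M (hu s)
  · exact ((hφ.integral_hasStrictDerivAt 0 s).hasDerivAt.const_mul c).const_add _
  · exact (hMc _ (hG₂ _ (huH s)).1).trans (mul_le_mul_of_nonneg_left (hφu s hs) hc)

/-- The evolution generated by a dissipative generator is contractive. -/
theorem traceNorm_evolution_le {T : Superop ι} (hT : IsDissipative T) {ρ : Matrix ι ι ℂ}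
    (hρ : ρ.IsHermitian) {t : ℝ} (ht : 0 ≤ t) : traceNorm (evolution T t ρ) ≤ traceNorm ρ := by
  refine traceNorm_le_of_hasDerivAt hT (x := fun s => evolution T s ρ) (w := 0)
    (B := fun _ => traceNorm ρ) (b := 0) (fun s => ?_) (evolution_isHermitian hT hρ)
    (fun s => by simp [Matrix.IsHermitian]) (fun s => hasDerivAt_const _ _)
    (fun s _ => by simp [traceNorm_zero]) (by simp [evolution_zero]) ht
  simpa using hasDerivAt_evolution T ρ s

end Evolution

end Dynamics

/-! ### Superoperators acting on part of a region -/

section Extend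

variable {D : ℕ} {q : Site D → ℕ} {Z Z' Λ : Finset (Site D)}

theorem restrict_replace (h : Z ⊆ Λ) (σ : Cfg q Λ) (a : Cfg q Z) :
    restrict h (replace σ a) = a := by
  funext x
  simp [restrict, replace]

theorem replace_restrict (h : Z ⊆ Λ) (σ : Cfg q Λ) : replace σ (restrict h σ) = σ := by
  funext x
  simp [restrict, replace]

theorem replace_replace (σ : Cfg q Λ) (a b : Cfg q Z) : replace (replace σ a) b = replace σ b := by
  funext x
  by_cases hx : x.1 ∈ Z <;> simp [replace, hx]

theorem restrict_replace_of_disjoint (h : Z ⊆ Λ) (hd : Disjoint Z Z') (σ : Cfg q Λ)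
    (a : Cfg q Z') : restrict h (replace σ a) = restrict h σ := by
  funext x
  simp [restrict, replace, Finset.disjoint_left.1 hd x.2]

theorem replace_comm (hd : Disjoint Z Z') (σ : Cfg q Λ) (a : Cfg q Z) (b : Cfg q Z') :
    replace (replace σ a) b = replace (replace σ b) a := by
  funext x
  by_cases hx : x.1 ∈ Z
  · simp [replace, hx, Finset.disjoint_left.1 hd hx]
  · simp [replace, hx]

/-- Splitting a basis label of `Λ` into its parts in `Z` and in `Λ ∖ Z`. -/
def splitCfg (q : Site D → ℕ) (h : Z ⊆ Λ) : Cfg q Λ ≃ Cfg q Z × Cfg q (Λ \ Z) where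
  toFun σ := (restrict h σ, restrict Finset.sdiff_subset σ)
  invFun p x := if hx : x.1 ∈ Z then p.1 ⟨x.1, hx⟩ else p.2 ⟨x.1, Finset.mem_sdiff.2 ⟨x.2, hx⟩⟩
  left_inv σ := by
    funext x
    simp [restrict]
  right_inv p := by
    ext x
    · simp [restrict]
    · simp [restrict, (Finset.mem_sdiff.1 x.2).2]

theorem splitCfg_symm_eq_replace (h : Z ⊆ Λ) (σ : Cfg q Λ) (a : Cfg q Z) :
    (splitCfg q h).symm (a, restrict Finset.sdiff_subset σ) = replace σ a := rfl

/-- The operator on `𝓗_Z` with the matrix elements of `X` between labels that agree with `σ`,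
respectively `σ'`, outside `Z`. -/
def block (σ σ' : Cfg q Λ) : Op q Λ →ₗ[ℂ] Op q Z where
  toFun X := Matrix.of fun a b => X (replace σ a) (replace σ' b)
  map_add' _ _ := rfl
  map_smul' _ _ := rfl

theorem block_apply (σ σ' : Cfg q Λ) (X : Op q Λ) (a b : Cfg q Z) :
    block σ σ' X a b = X (replace σ a) (replace σ' b) := rfl

theorem extend_apply (h : Z ⊆ Λ) (T : Superop (Cfg q Z)) (X : Op q Λ) (σ σ' : Cfg q Λ) :
    extend h T X σ σ' = T (block σ σ' X) (restrict h σ) (restrict h σ') := rfl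

theorem apply_eq_block (h : Z ⊆ Λ) (X : Op q Λ) (σ σ' : Cfg q Λ) :
    X σ σ' = (block σ σ' X : Op q Z) (restrict h σ) (restrict h σ') := by
  rw [block_apply, replace_restrict, replace_restrict]

/-- `A ⊗ 1` on `𝓗_Λ`. -/
def lift (h : Z ⊆ Λ) (A : Op q Z) : Op q Λ := Matrix.of fun σ σ' =>
  if restrict (Finset.sdiff_subset (t := Z)) σ = restrict Finset.sdiff_subset σ' then
    A (restrict h σ) (restrict h σ') else 0

theorem lift_conjTranspose (h : Z ⊆ Λ) (A : Op q Z) : (lift h A)ᴴ = lift h Aᴴ := by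
  ext σ σ'
  simp only [lift, Matrix.conjTranspose_apply, Matrix.of_apply]
  by_cases hs : restrict (Finset.sdiff_subset (t := Z)) σ = restrict Finset.sdiff_subset σ'
  · rw [if_pos hs, if_pos hs.symm]
  · rw [if_neg hs, if_neg (Ne.symm hs), star_zero]

theorem sum_ite_agree (h : Z ⊆ Λ) (σ : Cfg q Λ) (f : Cfg q Λ → ℂ) :
    (∑ τ, if restrict (Finset.sdiff_subset (t := Z)) σ = restrict Finset.sdiff_subset τ then f τ
      else 0) = ∑ a : Cfg q Z, f (replace σ a) := by
  rw [← (splitCfg q h).symm.sum_comp, Fintype.sum_prod_type]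
  refine Finset.sum_congr rfl fun a _ => ?_
  have e : ∀ b, restrict (Finset.sdiff_subset (t := Z)) ((splitCfg q h).symm (a, b)) = b := fun b =>
    congrArg Prod.snd ((splitCfg q h).apply_symm_apply (a, b))
  simp only [e, Finset.sum_ite_eq, Finset.mem_univ, if_true, splitCfg_symm_eq_replace]

/-- A block fixes the labels outside `Z`, and `A ⊗ 1` does not change those. Identities between
operators on `Z` can thus be transferred to `Λ` block by block. -/
theorem block_lift_mul (h : Z ⊆ Λ) (A : Op q Z) (X : Op q Λ) (σ σ' : Cfg q Λ) :
    (block σ σ' (lift h A * X) : Op q Z) = A * block σ σ' X := by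
  ext a b
  change (lift h A * X) (replace σ a) (replace σ' b) = _
  simp only [Matrix.mul_apply, lift, Matrix.of_apply, ite_mul, zero_mul]
  rw [sum_ite_agree h]
  simp only [block_apply, restrict_replace, replace_replace]

theorem block_mul_lift (h : Z ⊆ Λ) (A : Op q Z) (X : Op q Λ) (σ σ' : Cfg q Λ) :
    (block σ σ' (X * lift h A) : Op q Z) = block σ σ' X * A := by
  ext a b
  change (X * lift h A) (replace σ a) (replace σ' b) = _
  simp only [Matrix.mul_apply, lift, Matrix.of_apply, mul_ite, mul_zero]
  rw [Finset.sum_congr rfl fun τ _ => if_congr eq_comm rfl rfl, sum_ite_agree h]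
  simp only [block_apply, restrict_replace, replace_replace]

theorem IsLindbladian.extend (h : Z ⊆ Λ) {T : Superop (Cfg q Z)} (hT : IsLindbladian T) :
    IsLindbladian (extend h T) := by
  obtain ⟨H, k, L, hH, hL⟩ := hT
  refine ⟨lift h H, k, fun j => lift h (L j), ?_, fun X => ?_⟩
  · rw [Matrix.IsHermitian, lift_conjTranspose, hH.eq]
  · ext σ σ'
    rw [extend_apply, hL, apply_eq_block h (_ + _)]
    simp only [map_add, map_sub, map_sum, map_smul, lift_conjTranspose, block_lift_mul,
      block_mul_lift, Matrix.mul_assoc]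
    simp only [← Matrix.mul_assoc, block_mul_lift]

theorem isDissipative_extend (h : Z ⊆ Λ) {T : Superop (Cfg q Z)} (hT : IsLindbladian T) :
    IsDissipative (extend h T) :=
  (hT.extend h).isDissipative

theorem superop_apply_eq_sum {ι : Type} [Fintype ι] [DecidableEq ι] (T : Superop ι)
    (X : Matrix ι ι ℂ) (i j : ι) :
    T X i j = ∑ a, ∑ b, X a b * T (Matrix.single a b 1) i j := by
  conv_lhs => rw [Matrix.matrix_eq_sum_single X, map_sum, Matrix.sum_apply]
  refine Finset.sum_congr rfl fun a _ => ?_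
  rw [map_sum, Matrix.sum_apply]
  refine Finset.sum_congr rfl fun b _ => ?_
  rw [show Matrix.single a b (X a b) = X a b • Matrix.single a b (1 : ℂ) by
    rw [Matrix.smul_single, smul_eq_mul, mul_one], map_smul, Matrix.smul_apply, smul_eq_mul]

theorem sum_comm_four {α β γ δ : Type*} [Fintype α] [Fintype β] [Fintype γ] [Fintype δ]
    (f : α → β → γ → δ → ℂ) :
    ∑ a, ∑ b, ∑ c, ∑ d, f a b c d = ∑ c, ∑ d, ∑ a, ∑ b, f a b c d :=
  (Finset.sum_congr rfl fun _ _ => Finset.sum_comm).trans <| Finset.sum_comm.trans <|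
    Finset.sum_congr rfl fun _ _ =>
      (Finset.sum_congr rfl fun _ _ => Finset.sum_comm).trans Finset.sum_comm

/-- Superoperators with disjoint supports commute. -/
theorem extend_comm (h : Z ⊆ Λ) (h' : Z' ⊆ Λ) (hd : Disjoint Z Z') (T : Superop (Cfg q Z))
    (T' : Superop (Cfg q Z')) (X : Op q Λ) :
    extend h T (extend h' T' X) = extend h' T' (extend h T X) := by
  ext σ σ'
  rw [extend_apply, extend_apply, superop_apply_eq_sum T, superop_apply_eq_sum T']
  have e1 : ∀ a b, (block σ σ' (extend h' T' X) : Op q Z) a b = ∑ c, ∑ d,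
      X (replace (replace σ a) c) (replace (replace σ' b) d) *
        T' (Matrix.single c d 1) (restrict h' σ) (restrict h' σ') := fun a b => by
    change extend h' T' X (replace σ a) (replace σ' b) = _
    rw [extend_apply, superop_apply_eq_sum T', restrict_replace_of_disjoint h' hd.symm,
      restrict_replace_of_disjoint h' hd.symm]
    rfl
  have e2 : ∀ c d, (block σ σ' (extend h T X) : Op q Z') c d = ∑ a, ∑ b,
      X (replace (replace σ a) c) (replace (replace σ' b) d) *
        T (Matrix.single a b 1) (restrict h σ) (restrict h σ') := fun c d => by
    change extend h T X (replace σ c) (replace σ' d) = _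
    rw [extend_apply, superop_apply_eq_sum T, restrict_replace_of_disjoint h hd,
      restrict_replace_of_disjoint h hd]
    simp only [replace_comm hd]
    rfl
  simp only [e1, e2, Finset.sum_mul]
  rw [sum_comm_four]
  refine Finset.sum_congr rfl fun c _ => Finset.sum_congr rfl fun d _ =>
    Finset.sum_congr rfl fun a _ => Finset.sum_congr rfl fun b _ => ?_
  ring

/-- Lets frustration freeness on `A(m)` annihilate the product state on the larger region `B`. -/
theorem extend_tensor {Λ' : Finset (Site D)} (hZ : Z ⊆ Λ') (h : Λ' ⊆ Λ) (T : Superop (Cfg q Z))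
    (ρ : Op q Λ') (τ : Op q (Λ \ Λ')) :
    extend (hZ.trans h) T (tensor h ρ τ) = tensor h (extend hZ T ρ) τ := by
  ext σ σ'
  have hd : Disjoint (Λ \ Λ') Z := Finset.disjoint_of_subset_right hZ Finset.sdiff_disjoint
  have e : (block σ σ' (tensor h ρ τ) : Op q Z) =
      τ (restrict Finset.sdiff_subset σ) (restrict Finset.sdiff_subset σ') •
        block (restrict h σ) (restrict h σ') ρ := by
    ext a b
    change ρ _ _ * τ _ _ = _
    rw [restrict_replace_of_disjoint _ hd, restrict_replace_of_disjoint _ hd, mul_comm]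
    rfl
  rw [extend_apply, e, map_smul, Matrix.smul_apply, smul_eq_mul, mul_comm]
  rfl

theorem tensor_zero {Λ' : Finset (Site D)} (h : Λ' ⊆ Λ) (τ : Op q (Λ \ Λ')) :
    tensor h (0 : Op q Λ') τ = 0 := by
  ext σ σ'
  simp [tensor]

theorem IsState.tensor {Λ' : Finset (Site D)} (h : Λ' ⊆ Λ) {ρ : Op q Λ'} {τ : Op q (Λ \ Λ')}
    (hρ : IsState ρ) (hτ : IsState τ) : IsState (tensor h ρ τ) := by
  have e : OpenLattice.tensor h ρ τ =
      (Matrix.kronecker ρ τ).submatrix (splitCfg q h) (splitCfg q h) := rfl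
  refine ⟨?_, ?_⟩
  · rw [e]
    exact (hρ.1.kronecker hτ.1).submatrix _
  · have : (OpenLattice.tensor h ρ τ).trace = (Matrix.kronecker ρ τ).trace :=
      (splitCfg q h).sum_comp fun i => Matrix.kronecker ρ τ i i
    exact this.trans ((Matrix.trace_kronecker ρ τ).trans (by rw [hρ.2, hτ.2, one_mul]))

theorem IsState.traceNorm_eq_one {ι : Type} [Fintype ι] [DecidableEq ι] {ρ : Matrix ι ι ℂ}
    (hρ : IsState ρ) : traceNorm ρ = 1 := by
  rw [traceNorm_of_posSemidef hρ.1, hρ.2, Complex.one_re]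

/-- Labelling the configurations of `Λ \ Z` by `Fin n` turns the extension into an ampliation, one
of those in the supremum defining the diamond norm. -/
theorem traceNorm_extend_le (h : Z ⊆ Λ) {T : Superop (Cfg q Z)} (hT : diamondNorm T ≠ ⊤)
    (X : Op q Λ) : traceNorm (extend h T X) ≤ (diamondNorm T).toReal * traceNorm X := by
  rcases eq_or_ne X 0 with rfl | hX
  · rw [map_zero, traceNorm_zero, mul_zero]
  let n := Fintype.card (Cfg q (Λ \ Z))
  let e : Cfg q Λ ≃ Cfg q Z × Fin n :=
    (splitCfg q h).trans (Equiv.prodCongr (Equiv.refl _) (Fintype.equivFin _))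
  have hrep : ∀ (σ : Cfg q Λ) (a : Cfg q Z), e.symm (a, (e σ).2) = replace σ a := fun σ a => by
    simp [e, ← splitCfg_symm_eq_replace h, splitCfg]
  have hext : extend h T X = (ampliate T n (X.submatrix e.symm e.symm)).submatrix e e := by
    ext σ σ'
    simp only [Matrix.submatrix_apply, ampliate, Matrix.of_apply, hrep]
    rfl
  have hne : X.submatrix e.symm e.symm ≠ 0 := fun h0 => hX (by
    ext σ σ'
    simpa using congrFun (congrFun h0 (e σ)) (e σ'))
  have hle : ENNReal.ofReal (traceNorm (ampliate T n (X.submatrix e.symm e.symm))) /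
      ENNReal.ofReal (traceNorm (X.submatrix e.symm e.symm)) ≤ diamondNorm T :=
    le_iSup_of_le n (le_iSup_of_le (X.submatrix e.symm e.symm) (le_iSup_of_le hne le_rfl))
  rw [ENNReal.div_le_iff_le_mul (Or.inr hT) (Or.inl ENNReal.ofReal_ne_top),
    traceNorm_submatrix_equiv, ← ENNReal.ofReal_toReal hT,
    ← ENNReal.ofReal_mul ENNReal.toReal_nonneg] at hle
  rw [hext, traceNorm_submatrix_equiv]
  exact (ENNReal.ofReal_le_ofReal_iff
    (mul_nonneg ENNReal.toReal_nonneg (traceNorm_nonneg _))).1 hle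

end Extend

/-! ### The lattice metric -/

section Distance

variable {D : ℕ}

theorem siteDist_self (x : Site D) : siteDist x x = 0 := by simp [siteDist]

theorem siteDist_triangle (x y z : Site D) : siteDist x z ≤ siteDist x y + siteDist y z := by
  unfold siteDist
  rw [← Finset.sum_add_distrib]
  exact Finset.sum_le_sum fun i _ => by omega

theorem siteDist_le_diam {Z : Finset (Site D)} {x y : Site D} (hx : x ∈ Z) (hy : y ∈ Z) :
    siteDist x y ≤ diam Z :=
  Finset.le_sup (f := fun p : Site D × Site D => siteDist p.1 p.2) (Finset.mk_mem_product hx hy)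

end Distance

/-! ### Local norms and their growth under the cut evolution -/

namespace UniformFamily

variable {D : ℕ} {q : Site D → ℕ} {F : UniformFamily D q} {ν : ℕ → ℝ} {v : ℝ}

/-- Finiteness is needed because `toReal` sends `⊤` to `0`. The set `Z` must be nonempty, as the
hypothesis weighs `‖𝓜_Z‖` with `|Z|`. -/
theorem LiebRobinson.bulk_ne_top (h : F.LiebRobinson ν v) {Z : Finset (Site D)} {x : Site D}
    (hx : x ∈ Z) : diamondNorm (F.bulk Z) ≠ ⊤ := by
  intro htop
  have h1 := (ENNReal.le_tsum (f := fun Z : {Z : Finset (Site D) // x ∈ Z} =>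
    diamondNorm (F.bulk Z) * (Z.1.card : ℝ≥0∞) * ENNReal.ofReal (ν (diam Z.1))) ⟨Z, hx⟩).trans
      (h.bulk_decay x)
  have h2 : (Z.card : ℝ≥0∞) ≠ 0 := by
    simpa using Finset.ne_empty_of_mem hx
  have h3 : ENNReal.ofReal (ν (diam Z)) ≠ 0 := by simpa using h.pos _
  simp only [htop, ENNReal.top_mul h2, ENNReal.top_mul h3, top_le_iff] at h1
  exact ENNReal.ofReal_ne_top h1

theorem LiebRobinson.bulk_sum_le (h : F.LiebRobinson ν v) {x : Site D}
    {s : Finset (Finset (Site D))} (hs : ∀ Z ∈ s, x ∈ Z) :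
    ∑ Z ∈ s, (diamondNorm (F.bulk Z)).toReal * (Z.card * ν (diam Z)) ≤ v := by
  classical
  have h1 := (ENNReal.sum_le_tsum (f := fun Z : {Z : Finset (Site D) // x ∈ Z} =>
    diamondNorm (F.bulk Z) * (Z.1.card : ℝ≥0∞) * ENNReal.ofReal (ν (diam Z.1)))
      (s.subtype (x ∈ ·))).trans (h.bulk_decay x)
  rw [Finset.sum_subtype_of_mem (fun Z : Finset (Site D) =>
    diamondNorm (F.bulk Z) * (Z.card : ℝ≥0∞) * ENNReal.ofReal (ν (diam Z))) hs] at h1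
  have h2 : ∀ Z ∈ s, ENNReal.ofReal ((diamondNorm (F.bulk Z)).toReal * (Z.card * ν (diam Z))) =
      diamondNorm (F.bulk Z) * (Z.card : ℝ≥0∞) * ENNReal.ofReal (ν (diam Z)) := fun Z hZ => by
    rw [ENNReal.ofReal_mul ENNReal.toReal_nonneg, ENNReal.ofReal_mul (Nat.cast_nonneg _),
      ENNReal.ofReal_toReal (h.bulk_ne_top (hs Z hZ)), ENNReal.ofReal_natCast, mul_assoc]
  rw [← Finset.sum_congr rfl h2, ← ENNReal.ofReal_sum_of_nonneg fun Z _ =>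
    mul_nonneg ENNReal.toReal_nonneg (mul_nonneg (Nat.cast_nonneg _) (h.pos _).le)] at h1
  exact (ENNReal.ofReal_le_ofReal_iff h.nonneg).1 h1

theorem LiebRobinson.bd_ne_top (h : F.LiebRobinson ν v) {u : Site D} {N d : ℕ} (hd : 1 ≤ d)
    (hdN : d ≤ N + 1) : diamondNorm (F.bd u N d) ≠ ⊤ := by
  obtain ⟨P, hP⟩ := h.bd_decay
  intro htop
  have h1 : ∑ d ∈ Finset.Icc 1 (N + 1), diamondNorm (F.bd u N d) = ⊤ :=
    ENNReal.sum_eq_top.2 ⟨d, Finset.mem_Icc.2 ⟨hd, hdN⟩, htop⟩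
  have h2 := hP u N 1 le_rfl
  have h3 : ENNReal.ofReal (ν 1) ≠ 0 := by simpa using h.pos _
  rw [h1, ENNReal.mul_top h3, top_le_iff] at h2
  exact ENNReal.ofReal_ne_top h2

theorem LiebRobinson.bd_sum_le (h : F.LiebRobinson ν v) {u : Site D} {N r : ℕ} (hr : 1 ≤ r)
    {p : ℝ} (hp0 : 0 ≤ p)
    (hp : ENNReal.ofReal (ν r) * ∑ d ∈ Finset.Icc r (N + 1), diamondNorm (F.bd u N d) ≤
      ENNReal.ofReal p) :
    ν r * ∑ d ∈ Finset.Icc r (N + 1), (diamondNorm (F.bd u N d)).toReal ≤ p := by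
  have h1 : ∀ d ∈ Finset.Icc r (N + 1), ENNReal.ofReal (diamondNorm (F.bd u N d)).toReal =
      diamondNorm (F.bd u N d) := fun d hd =>
    ENNReal.ofReal_toReal (h.bd_ne_top (hr.trans (Finset.mem_Icc.1 hd).1) (Finset.mem_Icc.1 hd).2)
  rw [← Finset.sum_congr rfl h1, ← ENNReal.ofReal_sum_of_nonneg fun _ _ => ENNReal.toReal_nonneg,
    ← ENNReal.ofReal_mul (h.pos _).le] at hp
  exact (ENNReal.ofReal_le_ofReal_iff hp0).1 hp

theorem isDissipative_bulkGen (F : UniformFamily D q) {W Λ : Finset (Site D)} (h : W ⊆ Λ) :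
    IsDissipative (F.bulkGen h) :=
  isDissipative_sum _ fun Z _ => isDissipative_extend _ (F.bulk_lindbladian Z)

theorem isDissipative_bdTerm (F : UniformFamily D q) {𝓒 : Finset (Site D × ℕ)} (c : 𝓒) (d : ℕ) :
    IsDissipative (F.bdTerm c d) :=
  isDissipative_extend _ (F.bd_lindbladian _ _ _)

theorem isDissipative_closedGen (F : UniformFamily D q) (𝓒 : Finset (Site D × ℕ)) :
    IsDissipative (F.closedGen 𝓒) :=
  (F.isDissipative_bulkGen _).add (isDissipative_sum _ fun c _ =>
    isDissipative_sum _ fun d _ => F.isDissipative_bdTerm c d)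

theorem isDissipative_cutGen (F : UniformFamily D q) (𝓒 : Finset (Site D × ℕ))
    (A : Finset (Site D)) (k : ℕ) : IsDissipative (F.cutGen 𝓒 A k) :=
  (F.isDissipative_bulkGen _).add (isDissipative_sum _ fun c _ =>
    isDissipative_sum _ fun d _ => F.isDissipative_bdTerm c d)

open Classical in
/-- `‖𝓜_Z(X)‖₁` for `Z ⊆ Λ`. -/
noncomputable def bulkNorm (F : UniformFamily D q) {Λ : Finset (Site D)} (X : Op q Λ)
    (Z : Finset (Site D)) : ℝ :=
  if h : Z ⊆ Λ then traceNorm (extend h (F.bulk Z) X) else 0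

theorem bulkNorm_of_subset {Λ : Finset (Site D)} (X : Op q Λ) {Z : Finset (Site D)} (h : Z ⊆ Λ) :
    F.bulkNorm X Z = traceNorm (extend h (F.bulk Z) X) := dif_pos h

theorem bulkNorm_nonneg {Λ : Finset (Site D)} (X : Op q Λ) (Z : Finset (Site D)) :
    0 ≤ F.bulkNorm X Z := by
  unfold bulkNorm
  split_ifs
  exacts [traceNorm_nonneg _, le_rfl]

open Classical in
/-- `∑_{Z ∋ x, Z ⊆ Λ} ‖𝓜_Z(X)‖₁`. -/
noncomputable def siteNorm (F : UniformFamily D q) {Λ : Finset (Site D)} (X : Op q Λ)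
    (x : Site D) : ℝ :=
  ∑ Z ∈ Λ.powerset with x ∈ Z, F.bulkNorm X Z

theorem siteNorm_nonneg {Λ : Finset (Site D)} (X : Op q Λ) (x : Site D) : 0 ≤ F.siteNorm X x :=
  Finset.sum_nonneg fun _ _ => F.bulkNorm_nonneg _ _

theorem continuous_siteNorm {Λ : Finset (Site D)} {u : ℝ → Op q Λ} (hu : Continuous u)
    (huH : ∀ t, (u t).IsHermitian) (x : Site D) : Continuous fun t => F.siteNorm (u t) x := by
  classical
  refine continuous_finsetSum _ fun Z hZ => ?_
  have hZΛ : Z ⊆ Λ := Finset.mem_powerset.1 (Finset.mem_filter.1 hZ).1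
  simp only [bulkNorm_of_subset _ hZΛ]
  refine continuous_traceNorm
    (fun t => (isDissipative_extend hZΛ (F.bulk_lindbladian Z) _ (huH t)).1) ?_
  exact (LinearMap.continuous_of_finiteDimensional (extend hZΛ (F.bulk Z))).comp hu

open Classical in
-- Each `Z` is charged to a site that it shares with `Y`.
theorem sum_bulkNorm_le_sum_siteNorm {Λ : Finset (Site D)} (X : Op q Λ)
    {s : Finset (Finset (Site D))} {Y : Finset (Site D)}
    (hs : ∀ Z ∈ s, Z ⊆ Λ ∧ ¬ Disjoint Z Y) :
    ∑ Z ∈ s, F.bulkNorm X Z ≤ ∑ y ∈ Y, F.siteNorm X y := by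
  simp only [siteNorm, Finset.sum_filter]
  rw [Finset.sum_comm]
  refine (Finset.sum_le_sum fun Z hZ => ?_).trans (Finset.sum_le_sum_of_subset_of_nonneg
    (fun Z hZ => Finset.mem_powerset.2 (hs Z hZ).1) fun Z _ _ => Finset.sum_nonneg fun y _ => ?_)
  · obtain ⟨y, hyZ, hyY⟩ := Finset.not_disjoint_iff.1 (hs Z hZ).2
    refine le_trans (by rw [if_pos hyZ]) (Finset.single_le_sum
      (f := fun y => if y ∈ Z then F.bulkNorm X Z else 0) (fun y _ => ?_) hyY)
    split_ifs
    exacts [F.bulkNorm_nonneg _ _, le_rfl]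
  · split_ifs
    exacts [F.bulkNorm_nonneg _ _, le_rfl]

open Classical in
/-- Growth of `‖𝓜_Y(u)‖₁` along the evolution generated by `cutGen`: only the terms that meet `Y`
contribute. -/
theorem bulkNorm_le_integral (hLR : F.LiebRobinson ν v) {𝓒 : Finset (Site D × ℕ)}
    {A : Finset (Site D)} {k : ℕ} {u : ℝ → Op q (region 𝓒)}
    (hu : ∀ t, HasDerivAt u (F.cutGen 𝓒 A k (u t)) t) (huH : ∀ t, (u t).IsHermitian)
    (hu1 : ∀ t, 0 ≤ t → traceNorm (u t) ≤ 1) {Y : Finset (Site D)} (hY : Y ⊆ region 𝓒)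
    {x : Site D} (hx : x ∈ Y) {t : ℝ} (ht : 0 ≤ t) :
    F.bulkNorm (u t) Y ≤ F.bulkNorm (u 0) Y + (diamondNorm (F.bulk Y)).toReal *
      ∫ s in (0 : ℝ)..t, (∑ y ∈ Y, F.siteNorm (u s) y +
        ∑ c : 𝓒, ∑ d ∈ Finset.Icc 1 (c.1.2 + 1) with d ≤ k,
          if Disjoint (bdry d (ball c.1.1 c.1.2)) Y then 0
          else (diamondNorm (F.bd c.1.1 c.1.2 d)).toReal) := by
  have huc : Continuous u := continuous_of_hasDerivAt hu
  let K : (region 𝓒 \ A).powerset → Superop (Cfg q (region 𝓒)) := fun Z =>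
    extend ((Finset.mem_powerset.1 Z.2).trans Finset.sdiff_subset) (F.bulk Z)
  have hK : ∀ Z, IsDissipative (K Z) := fun Z => isDissipative_extend _ (F.bulk_lindbladian _)
  have hKc : ∀ Z : (region 𝓒 \ A).powerset, Disjoint Z.1 Y → ∀ X,
      extend hY (F.bulk Y) (K Z X) = K Z (extend hY (F.bulk Y) X) := fun Z hd X =>
    extend_comm hY ((Finset.mem_powerset.1 Z.2).trans Finset.sdiff_subset) hd.symm _ _ X
  have hbc : ∀ (c : 𝓒) (d : ℕ), Disjoint (bdry d (ball c.1.1 c.1.2)) Y → ∀ X,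
      extend hY (F.bulk Y) (F.bdTerm c d X) = F.bdTerm c d (extend hY (F.bulk Y) X) :=
    fun c d hd X => extend_comm hY ((bdry_subset d _).trans (ball_subset_region c.2)) hd.symm _ _ X
  have hKn : ∀ (Z : (region 𝓒 \ A).powerset) (X : Op q (region 𝓒)),
      traceNorm (K Z X) = F.bulkNorm X Z.1 := fun Z X =>
    (bulkNorm_of_subset X ((Finset.mem_powerset.1 Z.2).trans Finset.sdiff_subset)).symm
  -- `G₁` collects the terms supported off `Y`, which commute with `𝓜_Y` and do not increase its
  -- norm on `u`; `G₂` collects the terms that meet `Y`.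
  let G₁ : Superop (Cfg q (region 𝓒)) := (∑ Z with Disjoint Z.1 Y, K Z) +
    ∑ c : 𝓒, ∑ d ∈ Finset.Icc 1 (c.1.2 + 1) with d ≤ k,
      if Disjoint (bdry d (ball c.1.1 c.1.2)) Y then F.bdTerm c d else 0
  let G₂ : Superop (Cfg q (region 𝓒)) := (∑ Z with ¬ Disjoint Z.1 Y, K Z) +
    ∑ c : 𝓒, ∑ d ∈ Finset.Icc 1 (c.1.2 + 1) with d ≤ k,
      if Disjoint (bdry d (ball c.1.1 c.1.2)) Y then 0 else F.bdTerm c d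
  have hG : F.cutGen 𝓒 A k = G₁ + G₂ := by
    have e : F.cutGen 𝓒 A k = (∑ Z, K Z) +
      ∑ c : 𝓒, ∑ d ∈ Finset.Icc 1 (c.1.2 + 1) with d ≤ k, F.bdTerm c d := rfl
    clear_value K
    rw [e, add_add_add_comm, Finset.sum_filter_add_sum_filter_not, ← Finset.sum_add_distrib]
    congr 1
    refine Finset.sum_congr rfl fun c _ => ?_
    rw [← Finset.sum_add_distrib]
    refine Finset.sum_congr rfl fun d _ => ?_
    split_ifs <;> simp
  clear_value K
  have hG₁ : IsDissipative G₁ := (isDissipative_sum _ fun Z _ => hK Z).add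
    (isDissipative_sum _ fun c _ => isDissipative_sum _ fun d _ => by
      split_ifs
      exacts [F.isDissipative_bdTerm c d, isDissipative_zero])
  have hG₂ : IsDissipative G₂ := (isDissipative_sum _ fun Z _ => hK Z).add
    (isDissipative_sum _ fun c _ => isDissipative_sum _ fun d _ => by
      split_ifs
      exacts [isDissipative_zero, F.isDissipative_bdTerm c d])
  rw [bulkNorm_of_subset _ hY, bulkNorm_of_subset _ hY]
  refine traceNorm_apply_le_integral hG₁ hG₂ (isDissipative_extend hY (F.bulk_lindbladian Y)) ?_
    (fun t => hG ▸ hu t) huH ENNReal.toReal_nonneg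
    (fun X _ => traceNorm_extend_le hY (hLR.bulk_ne_top hx) X) ?_ ?_ ht
  · intro X
    simp only [G₁, LinearMap.add_apply, LinearMap.sum_apply, map_add, map_sum]
    refine congrArg₂ _ (Finset.sum_congr rfl fun Z hZ =>
      hKc Z (Finset.mem_filter.1 hZ).2 X) ?_
    refine Finset.sum_congr rfl fun c _ => Finset.sum_congr rfl fun d _ => ?_
    split_ifs with hd
    · exact hbc c d hd X
    · rw [LinearMap.zero_apply, LinearMap.zero_apply, map_zero]
  · exact (continuous_finsetSum _ fun y _ => continuous_siteNorm huc huH y).add continuous_const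
  · intro s hs
    have h1 : traceNorm ((∑ Z with ¬ Disjoint Z.1 Y, K Z) (u s)) ≤
        ∑ y ∈ Y, F.siteNorm (u s) y := by
      rw [LinearMap.sum_apply]
      refine (traceNorm_sum_le _ fun Z _ => (hK Z _ (huH s)).1).trans ?_
      rw [Finset.sum_congr rfl fun Z _ => hKn Z (u s), Finset.sum_filter,
        Finset.sum_coe_sort (region 𝓒 \ A).powerset
          (fun Z => if ¬ Disjoint Z Y then F.bulkNorm (u s) Z else 0), ← Finset.sum_filter]
      refine sum_bulkNorm_le_sum_siteNorm _ fun Z hZ => ?_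
      rw [Finset.mem_filter, Finset.mem_powerset] at hZ
      exact ⟨hZ.1.trans Finset.sdiff_subset, hZ.2⟩
    have hH : ∀ (c : 𝓒) (d : ℕ), ((if Disjoint (bdry d (ball c.1.1 c.1.2)) Y then 0
        else F.bdTerm c d : Superop (Cfg q (region 𝓒))) (u s)).IsHermitian := fun c d => by
      split_ifs
      exacts [(isDissipative_zero _ (huH s)).1, (F.isDissipative_bdTerm c d _ (huH s)).1]
    have h2 : traceNorm ((∑ c : 𝓒, ∑ d ∈ Finset.Icc 1 (c.1.2 + 1) with d ≤ k,
        if Disjoint (bdry d (ball c.1.1 c.1.2)) Y then 0 else F.bdTerm c d :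
          Superop (Cfg q (region 𝓒))) (u s)) ≤
        ∑ c : 𝓒, ∑ d ∈ Finset.Icc 1 (c.1.2 + 1) with d ≤ k,
          if Disjoint (bdry d (ball c.1.1 c.1.2)) Y then 0
          else (diamondNorm (F.bd c.1.1 c.1.2 d)).toReal := by
      simp only [LinearMap.sum_apply]
      refine (traceNorm_sum_le _ fun c _ => isHermitian_sum _ fun d _ => hH c d).trans
        (Finset.sum_le_sum fun c _ => (traceNorm_sum_le _ fun d _ => hH c d).trans
          (Finset.sum_le_sum fun d hd => ?_))
      rw [Finset.mem_filter, Finset.mem_Icc] at hd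
      split_ifs
      · simp [traceNorm_zero]
      · refine (traceNorm_extend_le _ (hLR.bd_ne_top hd.1.1 hd.1.2) _).trans ?_
        exact mul_le_of_le_one_right ENNReal.toReal_nonneg (hu1 s hs)
    rw [show G₂ (u s) = _ from LinearMap.add_apply _ _ _]
    exact (traceNorm_add_le (by
      rw [LinearMap.sum_apply]
      exact isHermitian_sum _ fun Z _ => (hK Z _ (huH s)).1) (by
      simp only [LinearMap.sum_apply]
      exact isHermitian_sum _ fun c _ => isHermitian_sum _ fun d _ => hH c d)).trans
        (add_le_add h1 h2)

end UniformFamily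

/-! ### Grönwall's inequality and the weighted Lieb-Robinson bound -/

section Gronwall

/-- Grönwall's inequality for `φ ≤ v (1 + ∫ (φ + β))`. -/
theorem le_mul_exp_of_le_integral {φ : ℝ → ℝ} (hφ : Continuous φ) {v β : ℝ} (hv : 0 ≤ v)
    (hβ : 0 ≤ β) (hφ0 : ∀ t, 0 ≤ φ t)
    (h : ∀ t, 0 ≤ t → φ t ≤ v * (1 + ∫ s in (0 : ℝ)..t, (φ s + β))) {t : ℝ} (ht : 0 ≤ t) :
    φ t ≤ (v + β) * Real.exp (v * t) := by
  -- The shift by `β` gives `φ + β ≤ E`, hence `E' = v (φ + β) ≤ v E` with `E 0 = v + β`.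
  let E : ℝ → ℝ := fun t => v * (1 + ∫ s in (0 : ℝ)..t, (φ s + β)) + β
  have hE : ∀ t, HasDerivAt E (v * (φ t + β)) t := fun t =>
    ((((hφ.add continuous_const).integral_hasStrictDerivAt 0 t).hasDerivAt.const_add 1).const_mul
      v).add_const β
  have hEc : Continuous E := continuous_iff_continuousAt.2 fun t => (hE t).continuousAt
  have hEφ : ∀ t, 0 ≤ t → φ t + β ≤ E t := fun t ht => add_le_add_left (h t ht) β
  have key := norm_le_gronwallBound_of_norm_deriv_right_le (f := E) (a := 0) (b := t) (K := v)
    (ε := 0) (δ := v + β) hEc.continuousOn (fun s _ => (hE s).hasDerivWithinAt)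
    (by simp [E, abs_of_nonneg (add_nonneg hv hβ)]) (fun s hs => by
      have h1 := hEφ s hs.1
      have h2 := hφ0 s
      rw [Real.norm_of_nonneg (by positivity), Real.norm_of_nonneg (by linarith), add_zero]
      exact mul_le_mul_of_nonneg_left h1 hv) t ⟨ht, le_rfl⟩
  rw [gronwallBound_ε0, sub_zero] at key
  have := hEφ t ht
  have := Real.le_norm_self (E t)
  linarith

end Gronwall

namespace UniformFamily

variable {D : ℕ} {q : Site D → ℕ} {F : UniformFamily D q} {ν : ℕ → ℝ} {v : ℝ}

theorem LiebRobinson.weight_le (hLR : F.LiebRobinson ν v) {δ : Site D → ℕ}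
    (hδ : ∀ x y, δ x ≤ δ y + siteDist x y) {Z : Finset (Site D)} {x y : Site D} (hx : x ∈ Z)
    (hy : y ∈ Z) {r : ℕ} (hr : δ y ≤ r) : ν (δ x) ≤ ν (diam Z) * ν r := by
  have h1 : δ x ≤ diam Z + r := by
    have := hδ x y
    have := siteDist_le_diam hx hy
    omega
  exact (hLR.mono h1).trans (hLR.submul _ _)

open Classical in
/-- A Lieb-Robinson bound in the Schrödinger picture: if the local terms in `{δ ≠ 0}` annihilate
`u(0)`, then they almost annihilate `u(t)` where `δ` is large. -/
theorem LiebRobinson.siteNorm_le (hLR : F.LiebRobinson ν v) {𝓒 : Finset (Site D × ℕ)}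
    {A : Finset (Site D)} {k : ℕ} {u : ℝ → Op q (region 𝓒)}
    (hu : ∀ t, HasDerivAt u (F.cutGen 𝓒 A k (u t)) t) (huH : ∀ t, (u t).IsHermitian)
    (hu1 : ∀ t, 0 ≤ t → traceNorm (u t) ≤ 1) {δ : Site D → ℕ}
    (hδ : ∀ x y, δ x ≤ δ y + siteDist x y)
    (hδ0 : ∀ Z ⊆ region 𝓒, (∀ z ∈ Z, δ z ≠ 0) → F.bulkNorm (u 0) Z = 0)
    (hδd : ∀ c ∈ 𝓒, ∀ d, ∀ y ∈ bdry d (ball c.1 c.2), δ y ≤ d) {β : ℝ}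
    (hβ : ∑ c : 𝓒, ∑ d ∈ Finset.Icc 1 (c.1.2 + 1) with d ≤ k,
      ν d * (diamondNorm (F.bd c.1.1 c.1.2 d)).toReal ≤ β)
    {t : ℝ} (ht : 0 ≤ t) {x : Site D} (hx : x ∈ region 𝓒) :
    ν (δ x) * F.siteNorm (u t) x ≤ (v + β) * Real.exp (v * t) := by
  have hν : ∀ r, 0 ≤ ν r := fun r => (hLR.pos r).le
  have huc : Continuous u := continuous_of_hasDerivAt hu
  have hβ0 : 0 ≤ β := le_trans (Finset.sum_nonneg fun c _ => Finset.sum_nonneg fun d _ =>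
    mul_nonneg (hν _) ENNReal.toReal_nonneg) hβ
  let Φ : ℝ → (region 𝓒) → ℝ := fun s y => ν (δ y) * F.siteNorm (u s) y
  have hΦ0 : ∀ s y, 0 ≤ Φ s y := fun s y => mul_nonneg (hν _) (siteNorm_nonneg _ _)
  have hΦc : Continuous Φ := continuous_pi fun y =>
    continuous_const.mul (continuous_siteNorm huc huH y)
  -- The largest weighted site norm over the region; Grönwall is applied to this single function.
  let φ : ℝ → ℝ := fun s => ‖Φ s‖
  have hφc : Continuous φ := hΦc.norm
  have hφ : ∀ s, ∀ y ∈ region 𝓒, ν (δ y) * F.siteNorm (u s) y ≤ φ s := fun s y hy =>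
    (Real.le_norm_self _).trans (norm_le_pi_norm (Φ s) ⟨y, hy⟩)
  have hφ0 : ∀ s, 0 ≤ φ s := fun s => norm_nonneg _
  refine (hφ t x hx).trans (le_mul_exp_of_le_integral hφc hLR.nonneg hβ0 hφ0 ?_ ht)
  intro t ht
  have hI0 : 0 ≤ ∫ s in (0 : ℝ)..t, (φ s + β) :=
    intervalIntegral.integral_nonneg ht fun s _ => add_nonneg (hφ0 s) hβ0
  have hv := hLR.nonneg
  refine (pi_norm_le_iff_of_nonneg (by positivity)).2 fun ⟨x, hx⟩ => ?_
  rw [Real.norm_of_nonneg (hΦ0 _ _)]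
  change ν (δ x) * F.siteNorm (u t) x ≤ _
  set I := ∫ s in (0 : ℝ)..t, (φ s + β)
  have hterm : ∀ Z ∈ {Z ∈ (region 𝓒).powerset | x ∈ Z}, ν (δ x) * F.bulkNorm (u t) Z ≤
      (diamondNorm (F.bulk Z)).toReal * (Z.card * ν (diam Z)) * (1 + I) := by
    intro Z hZ
    rw [Finset.mem_filter, Finset.mem_powerset] at hZ
    obtain ⟨hZ, hxZ⟩ := hZ
    have hcard : (1 : ℝ) ≤ Z.card := by exact_mod_cast Finset.card_pos.2 ⟨x, hxZ⟩
    have hμ : 0 ≤ (diamondNorm (F.bulk Z)).toReal := ENNReal.toReal_nonneg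
    have h1 := bulkNorm_le_integral hLR hu huH hu1 hZ hxZ ht
    set g : ℝ → ℝ := fun s => ∑ y ∈ Z, F.siteNorm (u s) y +
        ∑ c : 𝓒, ∑ d ∈ Finset.Icc 1 (c.1.2 + 1) with d ≤ k,
          if Disjoint (bdry d (ball c.1.1 c.1.2)) Z then 0
          else (diamondNorm (F.bd c.1.1 c.1.2 d)).toReal with hg
    have hgc : Continuous g :=
      (continuous_finsetSum _ fun y _ => continuous_siteNorm huc huH y).add continuous_const
    have hinit : ν (δ x) * F.bulkNorm (u 0) Z ≤
        (diamondNorm (F.bulk Z)).toReal * (Z.card * ν (diam Z)) := by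
      -- Either `𝓜_Z` annihilates `u 0`, or `Z` reaches a point of depth `0`; then `δ x ≤ diam Z`
      -- and the trivial bound suffices.
      by_cases hz : ∀ z ∈ Z, δ z ≠ 0
      · rw [hδ0 Z hZ hz, mul_zero]
        exact mul_nonneg hμ (mul_nonneg (Nat.cast_nonneg _) (hν _))
      · push Not at hz
        obtain ⟨z, hz, hz0⟩ := hz
        have a1 : ν (δ x) ≤ ν (diam Z) := hLR.mono (by
          have := hδ x z
          have := siteDist_le_diam hxZ hz
          omega)
        have a2 : F.bulkNorm (u 0) Z ≤ (diamondNorm (F.bulk Z)).toReal := by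
          rw [bulkNorm_of_subset _ hZ]
          exact (traceNorm_extend_le hZ (hLR.bulk_ne_top hxZ) _).trans
            (mul_le_of_le_one_right hμ (hu1 0 le_rfl))
        calc ν (δ x) * F.bulkNorm (u 0) Z
            ≤ ν (diam Z) * (diamondNorm (F.bulk Z)).toReal :=
              mul_le_mul a1 a2 (bulkNorm_nonneg _ _) (hν _)
          _ ≤ (Z.card * ν (diam Z)) * (diamondNorm (F.bulk Z)).toReal :=
              mul_le_mul_of_nonneg_right (le_mul_of_one_le_left (hν _) hcard) hμ
          _ = _ := mul_comm _ _
    -- The sum over the sites of `Z` produces the factor `|Z|` present in the bulk hypothesis.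
    have hrate : ∀ s, ν (δ x) * g s ≤ Z.card * ν (diam Z) * (φ s + β) := fun s => by
      have b1 : ν (δ x) * ∑ y ∈ Z, F.siteNorm (u s) y ≤ Z.card * ν (diam Z) * φ s := by
        rw [Finset.mul_sum, mul_assoc, ← nsmul_eq_mul]
        refine Finset.sum_le_card_nsmul _ _ _ fun y hy => ?_
        calc ν (δ x) * F.siteNorm (u s) y
            ≤ ν (diam Z) * ν (δ y) * F.siteNorm (u s) y :=
              mul_le_mul_of_nonneg_right (hLR.weight_le hδ hxZ hy le_rfl) (siteNorm_nonneg _ _)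
          _ = ν (diam Z) * (ν (δ y) * F.siteNorm (u s) y) := mul_assoc _ _ _
          _ ≤ _ := mul_le_mul_of_nonneg_left (hφ s y (hZ hy)) (hν _)
      have b2 : ν (δ x) * ∑ c : 𝓒, ∑ d ∈ Finset.Icc 1 (c.1.2 + 1) with d ≤ k,
          (if Disjoint (bdry d (ball c.1.1 c.1.2)) Z then 0
          else (diamondNorm (F.bd c.1.1 c.1.2 d)).toReal) ≤ ν (diam Z) * β := by
        refine le_trans ?_ (mul_le_mul_of_nonneg_left hβ (hν _))
        simp only [Finset.mul_sum]
        refine Finset.sum_le_sum fun c _ => Finset.sum_le_sum fun d _ => ?_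
        split_ifs with hd
        · rw [mul_zero]
          exact mul_nonneg (hν _) (mul_nonneg (hν _) ENNReal.toReal_nonneg)
        · obtain ⟨y, hy, hyZ⟩ := Finset.not_disjoint_iff.1 hd
          rw [← mul_assoc]
          exact mul_le_mul_of_nonneg_right (hLR.weight_le hδ hxZ hyZ (hδd c.1 c.2 d y hy))
            ENNReal.toReal_nonneg
      have b3 : ν (diam Z) * β ≤ Z.card * ν (diam Z) * β :=
        mul_le_mul_of_nonneg_right (le_mul_of_one_le_left (hν _) hcard) hβ0
      rw [hg]
      simp only [mul_add]
      linarith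
    have hint : ν (δ x) * ∫ s in (0 : ℝ)..t, g s ≤ Z.card * ν (diam Z) * I := by
      rw [← intervalIntegral.integral_const_mul, ← intervalIntegral.integral_const_mul]
      exact intervalIntegral.integral_mono_on ht ((continuous_const.mul hgc).intervalIntegrable _ _)
        ((continuous_const.mul (hφc.add continuous_const)).intervalIntegrable _ _)
        fun s _ => hrate s
    have c1 := mul_le_mul_of_nonneg_left h1 (hν (δ x))
    have c2 := mul_le_mul_of_nonneg_left hint hμ
    linarith
  calc ν (δ x) * F.siteNorm (u t) x
      = ∑ Z ∈ (region 𝓒).powerset with x ∈ Z, ν (δ x) * F.bulkNorm (u t) Z := by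
        rw [siteNorm, Finset.mul_sum]
    _ ≤ _ := Finset.sum_le_sum hterm
    _ = (∑ Z ∈ (region 𝓒).powerset with x ∈ Z,
          (diamondNorm (F.bulk Z)).toReal * (Z.card * ν (diam Z))) * (1 + I) := by
        rw [Finset.sum_mul]
    _ ≤ v * (1 + I) := mul_le_mul_of_nonneg_right
        (hLR.bulk_sum_le fun Z hZ => (Finset.mem_filter.1 hZ).2) (by positivity)

end UniformFamily

/-! ### Disjoint unions of balls, hulls and depth -/

section Geometry

variable {D : ℕ}

theorem exists_siteDist_succ {x y : Site D} (h : siteDist x y ≠ 0) :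
    ∃ z, siteDist x z ≤ 1 ∧ siteDist z y + 1 = siteDist x y := by
  obtain ⟨i, -, hi⟩ : ∃ i ∈ Finset.univ, (x i - y i).natAbs ≠ 0 := by
    by_contra! hc
    exact h (Finset.sum_eq_zero hc)
  let z : Site D := Function.update x i (if x i < y i then x i + 1 else x i - 1)
  have hz : ∀ j ∈ Finset.univ.erase i, z j = x j := fun j hj =>
    Function.update_of_ne (Finset.ne_of_mem_erase hj) _ _
  have hzi : z i = if x i < y i then x i + 1 else x i - 1 := Function.update_self _ _ _
  refine ⟨z, ?_, ?_⟩
  · unfold siteDist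
    rw [← Finset.add_sum_erase _ _ (Finset.mem_univ i), Finset.sum_eq_zero fun j hj => by
      rw [hz j hj, sub_self, Int.natAbs_zero], hzi]
    split_ifs <;> omega
  · unfold siteDist
    rw [← Finset.add_sum_erase _ _ (Finset.mem_univ i),
      ← Finset.add_sum_erase _ (fun j => (x j - y j).natAbs) (Finset.mem_univ i),
      Finset.sum_congr rfl fun j hj => by rw [hz j hj], hzi]
    split_ifs <;> omega

/-- A shortest path that leaves a component of a disjoint union of balls leaves the union. -/
theorem IsDisjointUnion.exists_notMem {𝓒 : Finset (Site D × ℕ)} (h𝓒 : IsDisjointUnion 𝓒)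
    {c : Site D × ℕ} (hc : c ∈ 𝓒) {y z : Site D} (hy : y ∈ ball c.1 c.2)
    (hz : z ∉ ball c.1 c.2) : ∃ w, w ∉ region 𝓒 ∧ siteDist y w ≤ siteDist y z := by
  obtain ⟨n, hn⟩ : ∃ n, siteDist y z = n := ⟨_, rfl⟩
  induction n generalizing y with
  | zero =>
    refine absurd (mem_ball.2 ?_) hz
    have := siteDist_triangle c.1 y z
    have := mem_ball.1 hy
    omega
  | succ n ih =>
    obtain ⟨y', h1, h2⟩ := exists_siteDist_succ (x := y) (y := z) (by omega)
    by_cases hy' : y' ∈ ball c.1 c.2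
    · obtain ⟨w, hw, hwd⟩ := ih hy' (by omega)
      have := siteDist_triangle y y' w
      exact ⟨w, hw, by omega⟩
    -- The first point outside the ball is within distance `1` of it, whereas other components are
    -- at distance at least `2`.
    · refine ⟨y', fun hmem => ?_, by omega⟩
      obtain ⟨c', hc', hyc'⟩ := Finset.mem_biUnion.1 hmem
      have := h𝓒 c hc c' hc' (fun e => hy' (e ▸ hyc')) y hy y' hyc'
      omega

/-- The ball contains a coordinate segment of `r + 1` sites. This bounds the radii of the
components, and hence the polynomials in them, by the size of the region. -/
theorem lt_card_ball (hD : 1 ≤ D) (u : Site D) (r : ℕ) : r < (ball u r).card := by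
  have h : (Finset.range (r + 1)).card ≤ (ball u r).card := by
    refine Finset.card_le_card_of_injOn
      (fun j => Function.update u ⟨0, hD⟩ (u ⟨0, hD⟩ + j)) (fun j hj => ?_) fun a _ b _ hab => ?_
    · rw [Finset.coe_range, Set.mem_Iio] at hj
      beta_reduce
      rw [Finset.mem_coe, mem_ball, siteDist, ← Finset.add_sum_erase _ _ (Finset.mem_univ ⟨0, hD⟩),
        Finset.sum_eq_zero fun i hi => by
          rw [Function.update_of_ne (Finset.ne_of_mem_erase hi), sub_self, Int.natAbs_zero],
        Function.update_self]
      omega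
    · have := congrFun hab ⟨0, hD⟩
      simp only [Function.update_self] at this
      omega
  rwa [Finset.card_range] at h

theorem card_ball_le (u : Site D) (r : ℕ) : (ball u r).card ≤ (2 * r + 1) ^ D := by
  refine (Finset.card_filter_le _ _).trans ?_
  rw [Pi.card_Icc]
  simp only [Int.card_Icc]
  rw [Finset.prod_congr rfl fun i _ => show (u i + r + 1 - (u i - r)).toNat = 2 * r + 1 by omega]
  simp

theorem IsDisjointUnion.card_le {𝓒 : Finset (Site D × ℕ)} (h𝓒 : IsDisjointUnion 𝓒) :
    𝓒.card ≤ (region 𝓒).card := by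
  have self_mem : ∀ c : Site D × ℕ, c.1 ∈ ball c.1 c.2 := fun c =>
    mem_ball.2 (by rw [siteDist_self]; exact Nat.zero_le _)
  refine Finset.card_le_card_of_injOn Prod.fst
    (fun c hc => ball_subset_region hc (self_mem c)) fun c hc c' hc' h => ?_
  by_contra hne
  have := h𝓒 c hc c' hc' hne c.1 (self_mem c) c'.1 (self_mem c')
  rw [show c.1 = c'.1 from h, siteDist_self] at this
  omega

theorem radius_le_card (hD : 1 ≤ D) {𝓒 : Finset (Site D × ℕ)} {c : Site D × ℕ} (hc : c ∈ 𝓒) :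
    c.2 ≤ (region 𝓒).card :=
  (lt_card_ball hD c.1 c.2).le.trans (Finset.card_le_card (ball_subset_region hc))

/-- The single ball of radius `K + s` about the origin competes in the minimization. -/
theorem IsHull.card_le {A : Finset (Site D)} {s K : ℕ} (hK : A ⊆ ball 0 K)
    {𝓒 : Finset (Site D × ℕ)} (h : IsHull A s 𝓒) : (region 𝓒).card ≤ (2 * (K + s) + 1) ^ D := by
  have hreg : region {((0 : Site D), K + s)} = ball 0 (K + s) := by simp [region]
  refine (h.2.2 {(0, K + s)} (fun c hc c' hc' hne => ?_) fun x hx => ?_).trans ?_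
  · rw [Finset.mem_singleton] at hc hc'
    exact absurd (hc.trans hc'.symm) hne
  · obtain ⟨a, ha, hxa⟩ := Finset.mem_biUnion.1 hx
    rw [hreg, mem_ball]
    have := mem_ball.1 hxa
    have := mem_ball.1 (hK ha)
    have := siteDist_triangle 0 a x
    omega
  · rw [hreg]
    exact card_ball_le 0 _

theorem exists_subset_ball (A : Finset (Site D)) : ∃ K, A ⊆ ball 0 K :=
  ⟨A.sup (siteDist 0), fun _ ha => mem_ball.2 (Finset.le_sup (f := siteDist 0) ha)⟩

/-- The depth `max(0, s + 1 - dist(x, A))` of `x` inside the neighbourhood of `A`. -/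
def depth (A : Finset (Site D)) (s : ℕ) (x : Site D) : ℕ := A.sup fun a => s + 1 - siteDist a x

theorem depth_le_add (A : Finset (Site D)) (s : ℕ) (x y : Site D) :
    depth A s x ≤ depth A s y + siteDist x y := by
  refine Finset.sup_le fun a ha => ?_
  have := Finset.le_sup (f := fun a => s + 1 - siteDist a y) ha
  have := siteDist_triangle a x y
  change _ ≤ (A.sup fun a => s + 1 - siteDist a y) + _
  omega

theorem le_depth {A : Finset (Site D)} (s : ℕ) {x : Site D} (hx : x ∈ A) : s + 1 ≤ depth A s x := by
  have := Finset.le_sup (f := fun a => s + 1 - siteDist a x) hx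
  rwa [siteDist_self] at this

theorem depth_eq_zero {A : Finset (Site D)} {s : ℕ} {x : Site D} (hx : x ∉ nbhd A s) :
    depth A s x = 0 := by
  refine Nat.le_zero.1 (Finset.sup_le fun a ha => ?_)
  have : ¬ siteDist a x ≤ s := fun h => hx (Finset.mem_biUnion.2 ⟨a, ha, mem_ball.2 h⟩)
  omega

/-- A point within `d` of the complement of its component is within `d` of the complement of the
whole region, where the depth vanishes; and depth is 1-Lipschitz. -/
theorem depth_le_of_mem_bdry {A : Finset (Site D)} {s : ℕ} {𝓒 : Finset (Site D × ℕ)}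
    (h𝓒 : IsDisjointUnion 𝓒) (hA : nbhd A s ⊆ region 𝓒) {c : Site D × ℕ} (hc : c ∈ 𝓒) {d : ℕ}
    {y : Site D} (hy : y ∈ bdry d (ball c.1 c.2)) : depth A s y ≤ d := by
  classical
  obtain ⟨hyc, z, hz, hyz⟩ := Finset.mem_filter.1 hy
  obtain ⟨w, hw, hyw⟩ := h𝓒.exists_notMem hc hyc hz
  have := depth_le_add A s y w
  rw [depth_eq_zero fun h => hw (hA h)] at this
  omega

end Geometry

/-- Every real polynomial has a nonnegative monotone majorant on `[0, ∞)`. -/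
theorem exists_monotone_majorant (P : Polynomial ℝ) : ∃ Q : Polynomial ℝ,
    (∀ x, 0 ≤ x → P.eval x ≤ Q.eval x) ∧ (∀ x, 0 ≤ x → 0 ≤ Q.eval x) ∧
      ∀ x y, 0 ≤ x → x ≤ y → Q.eval x ≤ Q.eval y := by
  -- The majorant replaces coefficients by their absolute values.
  induction P using Polynomial.induction_on' with
  | add P P' h h' =>
    obtain ⟨Q, h1, h2, h3⟩ := h
    obtain ⟨Q', h1', h2', h3'⟩ := h'
    refine ⟨Q + Q', fun x hx => ?_, fun x hx => ?_, fun x y hx hxy => ?_⟩ <;>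
      simp only [Polynomial.eval_add]
    exacts [add_le_add (h1 x hx) (h1' x hx), add_nonneg (h2 x hx) (h2' x hx),
      add_le_add (h3 x y hx hxy) (h3' x y hx hxy)]
  | monomial n a =>
    refine ⟨Polynomial.monomial n |a|, fun x hx => ?_, fun x hx => ?_, fun x y hx hxy => ?_⟩ <;>
      simp only [Polynomial.eval_monomial]
    · exact mul_le_mul_of_nonneg_right (le_abs_self a) (pow_nonneg hx n)
    · positivity
    · gcongr

/-- The right side is a multiple of the derivative of `e^{vs} - 1 + s`. The summand `1` is what
covers `v = 0`. -/
theorem exists_exp_le (v : ℝ) (hv : 0 ≤ v) :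
    ∃ κ : ℝ, 0 ≤ κ ∧ ∀ s : ℝ, Real.exp (v * s) ≤ κ * (Real.exp (v * s) * v + 1) := by
  rcases hv.eq_or_lt with rfl | hv
  · exact ⟨1, zero_le_one, fun s => by simp⟩
  · refine ⟨v⁻¹, by positivity, fun s => ?_⟩
    rw [mul_add, mul_comm _ v, inv_mul_cancel_left₀ hv.ne']
    have : 0 < v⁻¹ := by positivity
    linarith

/-! ### Difference of the generators and the final estimate -/

namespace UniformFamily

variable {D : ℕ} {q : Site D → ℕ} {F : UniformFamily D q} {ν : ℕ → ℝ} {v : ℝ}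

open Classical in
/-- `‖(𝓛^{Λ̄} - 𝓛^{Λ̄ ∖ A})(X)‖₁` is controlled by the bulk terms that meet `A` and the boundary
terms of depth more than `k`. -/
theorem traceNorm_closedGen_sub_cutGen_le (hLR : F.LiebRobinson ν v) {𝓒 : Finset (Site D × ℕ)}
    (A : Finset (Site D)) (k : ℕ) {X : Op q (region 𝓒)} (hX : X.IsHermitian)
    (hX1 : traceNorm X ≤ 1) :
    traceNorm (F.closedGen 𝓒 X - F.cutGen 𝓒 A k X) ≤ ∑ y ∈ A, F.siteNorm X y +
      ∑ c : 𝓒, ∑ d ∈ Finset.Icc 1 (c.1.2 + 1) with ¬ d ≤ k,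
        (diamondNorm (F.bd c.1.1 c.1.2 d)).toReal := by
  let f : Finset (Site D) → Op q (region 𝓒) := fun Z =>
    if h : Z ⊆ region 𝓒 then extend h (F.bulk Z) X else 0
  have hfH : ∀ Z, (f Z).IsHermitian := fun Z => by
    by_cases h : Z ⊆ region 𝓒
    · simp only [f, dif_pos h]
      exact (isDissipative_extend h (F.bulk_lindbladian Z) X hX).1
    · simp only [f, dif_neg h]
      exact Matrix.isHermitian_zero
  have hfN : ∀ Z, traceNorm (f Z) = F.bulkNorm X Z := fun Z => by
    by_cases h : Z ⊆ region 𝓒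
    · simp only [f, bulkNorm, dif_pos h]
    · simp only [f, bulkNorm, dif_neg h, traceNorm_zero]
  have hbulk : ∀ {W : Finset (Site D)} (h : W ⊆ region 𝓒),
      F.bulkGen h X = ∑ Z ∈ W.powerset, f Z := fun {W} h => by
    rw [bulkGen, LinearMap.sum_apply, ← Finset.sum_coe_sort W.powerset f]
    refine Finset.sum_congr rfl fun Z _ => ?_
    simp only [f, dif_pos ((Finset.mem_powerset.1 Z.2).trans h)]
  have hpow : (region 𝓒 \ A).powerset = {Z ∈ (region 𝓒).powerset | Disjoint Z A} := by
    ext Z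
    rw [Finset.mem_filter, Finset.mem_powerset, Finset.mem_powerset, Finset.subset_sdiff]
  have e : F.closedGen 𝓒 X - F.cutGen 𝓒 A k X =
      ∑ Z ∈ (region 𝓒).powerset with ¬ Disjoint Z A, f Z +
        ∑ c : 𝓒, ∑ d ∈ Finset.Icc 1 (c.1.2 + 1) with ¬ d ≤ k, F.bdTerm c d X := by
    rw [closedGen, cutGen, LinearMap.add_apply, LinearMap.add_apply, hbulk, hbulk, hpow,
      ← Finset.sum_filter_add_sum_filter_not (region 𝓒).powerset (fun Z => Disjoint Z A)]
    simp only [LinearMap.sum_apply]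
    rw [Finset.sum_congr rfl fun (c : 𝓒) _ => (Finset.sum_filter_add_sum_filter_not
      (Finset.Icc 1 (c.1.2 + 1)) (fun d => d ≤ k) fun d => F.bdTerm c d X).symm,
      Finset.sum_add_distrib]
    abel
  have hbH : ∀ (c : 𝓒) (d : ℕ), (F.bdTerm c d X).IsHermitian := fun c d =>
    (F.isDissipative_bdTerm c d X hX).1
  rw [e]
  refine (traceNorm_add_le (isHermitian_sum _ fun Z _ => hfH Z)
    (isHermitian_sum _ fun c _ => isHermitian_sum _ fun d _ => hbH c d)).trans (add_le_add ?_ ?_)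
  · refine (traceNorm_sum_le _ fun Z _ => hfH Z).trans ?_
    rw [Finset.sum_congr rfl fun Z _ => hfN Z]
    refine sum_bulkNorm_le_sum_siteNorm X fun Z hZ => ?_
    rwa [Finset.mem_filter, Finset.mem_powerset] at hZ
  · refine (traceNorm_sum_le _ fun c _ => isHermitian_sum _ fun d _ => hbH c d).trans
      (Finset.sum_le_sum fun c _ => (traceNorm_sum_le _ fun d _ => hbH c d).trans
        (Finset.sum_le_sum fun d hd => ?_))
    rw [Finset.mem_filter, Finset.mem_Icc] at hd
    exact (traceNorm_extend_le _ (hLR.bd_ne_top hd.1.1 hd.1.2) _).trans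
      (mul_le_of_le_one_right ENNReal.toReal_nonneg hX1)

end UniformFamily

end OpenLattice

theorem mainTheorem4 {D : ℕ} (hD : 1 ≤ D) (q : Site D → ℕ) (F : UniformFamily D q)
    (ν : ℕ → ℝ) (v : ℝ) (hLR : F.LiebRobinson ν v) (hFF : F.FrustrationFree)
    (A : Finset (Site D)) :
    ∃ P : Polynomial ℝ, ∀ m : ℕ, 1 ≤ m →
      ∀ 𝓐 𝓑 : Finset (Site D × ℕ), IsHull A m 𝓐 → IsHull A (m + 1) 𝓑 →
      ∀ hsub : region 𝓐 ⊆ region 𝓑,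
      ∀ ρ : Op q (region 𝓐), F.IsFixedState 𝓐 ρ →
      ∀ τ : Op q (region 𝓑 \ region 𝓐), IsState τ →
      ∀ t : ℝ, 0 ≤ t →
        traceNorm (evolution (F.closedGen 𝓑) t (tensor hsub ρ τ) -
            evolution (F.cutGen 𝓑 A (m + 1)) t (tensor hsub ρ τ)) ≤
          P.eval (m : ℝ) * (ν m)⁻¹ * (Real.exp (v * t) - 1 + t) := by
  classical
  obtain ⟨P₀, hP₀⟩ := hLR.bd_decay
  obtain ⟨Q, hPQ, hQ0, hQm⟩ := exists_monotone_majorant P₀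
  obtain ⟨K, hK⟩ := exists_subset_ball A
  obtain ⟨κ, hκ0, hκ⟩ := exists_exp_le v hLR.nonneg
  -- `R(m)` bounds the size of `B = A(m + 1)`, hence also the number of its components and their
  -- radii.
  let R : Polynomial ℝ := (2 * (Polynomial.C (K : ℝ) + (Polynomial.X + 1)) + 1) ^ D
  refine ⟨Polynomial.C (A.card * κ) * (Polynomial.C v + R * (R + 1) * Q.comp R) + R * Q.comp R,
    fun m hm 𝓐 𝓑 h𝓐 h𝓑 hsub ρ hρ τ hτ => ?_⟩
  have hν : ∀ r, 0 ≤ ν r := fun r => (hLR.pos r).le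
  have hcard : ((region 𝓑).card : ℝ) ≤ R.eval (m : ℝ) := by
    have := h𝓑.card_le hK
    simp only [R, Polynomial.eval_pow, Polynomial.eval_add, Polynomial.eval_mul,
      Polynomial.eval_C, Polynomial.eval_X, Polynomial.eval_one, Polynomial.eval_ofNat]
    exact_mod_cast this
  simp only [Polynomial.eval_add, Polynomial.eval_mul, Polynomial.eval_C, Polynomial.eval_one,
    Polynomial.eval_comp]
  generalize R.eval (m : ℝ) = r at hcard
  have hr0 : 0 ≤ r := (Nat.cast_nonneg _).trans hcard
  have hrad : ∀ c : 𝓑, ((c.1.2 : ℕ) : ℝ) ≤ r := fun c =>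
    (Nat.cast_le.2 (radius_le_card hD c.2)).trans hcard
  have hnum : (Fintype.card 𝓑 : ℝ) ≤ r := by
    rw [Fintype.card_coe]
    exact (Nat.cast_le.2 h𝓑.1.card_le).trans hcard
  have hbd : ∀ (c : 𝓑) (d : ℕ), 1 ≤ d → ν d * ∑ d' ∈ Finset.Icc d (c.1.2 + 1),
      (diamondNorm (F.bd c.1.1 c.1.2 d')).toReal ≤ Q.eval r := fun c d hd =>
    (hLR.bd_sum_le hd (hQ0 _ (Nat.cast_nonneg _)) ((hP₀ c.1.1 c.1.2 d hd).trans
      (ENNReal.ofReal_le_ofReal (hPQ _ (Nat.cast_nonneg _))))).trans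
        (hQm _ _ (Nat.cast_nonneg _) (hrad c))
  have hQr := hQ0 r hr0
  -- At most `r` components, at most `r + 1` depths in each, and `ν d * ‖𝓑_d‖ ≤ Q(r)` for every one
  -- of them.
  have hβ : ∑ c : 𝓑, ∑ d ∈ Finset.Icc 1 (c.1.2 + 1) with d ≤ m + 1,
      ν d * (diamondNorm (F.bd c.1.1 c.1.2 d)).toReal ≤ r * (r + 1) * Q.eval r := by
    have h1 : ∀ c : 𝓑, ∑ d ∈ Finset.Icc 1 (c.1.2 + 1) with d ≤ m + 1,
        ν d * (diamondNorm (F.bd c.1.1 c.1.2 d)).toReal ≤ (r + 1) * Q.eval r := fun c => by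
      refine (Finset.sum_le_card_nsmul _ _ (Q.eval r) fun d hd => ?_).trans ?_
      · rw [Finset.mem_filter, Finset.mem_Icc] at hd
        refine le_trans ?_ (hbd c d hd.1.1)
        exact mul_le_mul_of_nonneg_left (Finset.single_le_sum
          (f := fun d => (diamondNorm (F.bd c.1.1 c.1.2 d)).toReal)
          (fun _ _ => ENNReal.toReal_nonneg) (Finset.left_mem_Icc.2 hd.1.2)) (hν d)
      · rw [nsmul_eq_mul]
        refine mul_le_mul_of_nonneg_right ?_ hQr
        refine (Nat.cast_le.2 (Finset.card_filter_le _ _)).trans ?_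
        rw [Nat.card_Icc]
        have := hrad c
        push_cast
        linarith
    refine (Finset.sum_le_card_nsmul _ _ _ fun c _ => h1 c).trans ?_
    rw [nsmul_eq_mul, Finset.card_univ, mul_assoc]
    exact mul_le_mul_of_nonneg_right hnum (by positivity)
  have hγ : ν m * ∑ c : 𝓑, ∑ d ∈ Finset.Icc 1 (c.1.2 + 1) with ¬ d ≤ m + 1,
      (diamondNorm (F.bd c.1.1 c.1.2 d)).toReal ≤ r * Q.eval r := by
    rw [Finset.mul_sum]
    refine (Finset.sum_le_card_nsmul _ _ (Q.eval r) fun c _ => ?_).trans ?_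
    -- The cut drops exactly the boundary terms with `d ≥ m + 2`, so the tail hypothesis applies at
    -- `m + 2`.
    · refine le_trans (mul_le_mul (hLR.mono (show m ≤ m + 2 by omega))
        (Finset.sum_le_sum_of_subset_of_nonneg (fun d hd => ?_) fun _ _ _ =>
          ENNReal.toReal_nonneg) (Finset.sum_nonneg fun _ _ => ENNReal.toReal_nonneg) (hν _))
        (hbd c (m + 2) (by omega))
      rw [Finset.mem_filter, Finset.mem_Icc] at hd
      exact Finset.mem_Icc.2 ⟨by omega, hd.1.2⟩
    · rw [nsmul_eq_mul, Finset.card_univ]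
      exact mul_le_mul_of_nonneg_right hnum hQr
  generalize hβdef : r * (r + 1) * Q.eval r = β at hβ
  have hβ0 : 0 ≤ β := by rw [← hβdef]; positivity
  generalize r * Q.eval r = γ at hγ
  have hγ0 : 0 ≤ γ := le_trans (mul_nonneg (hν _) (Finset.sum_nonneg fun c _ =>
    Finset.sum_nonneg fun d _ => ENNReal.toReal_nonneg)) hγ
  -- the evolution with the cut generator
  have hst : IsState (tensor hsub ρ τ) := hρ.1.tensor hsub hτ
  have hH := hst.1.1
  have hdis := F.isDissipative_cutGen 𝓑 A (m + 1)
  let u : ℝ → Op q (region 𝓑) := fun s => evolution (F.cutGen 𝓑 A (m + 1)) s (tensor hsub ρ τ)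
  have hu : ∀ s, HasDerivAt u (F.cutGen 𝓑 A (m + 1) (u s)) s := hasDerivAt_evolution _ _
  have huH : ∀ s, (u s).IsHermitian := evolution_isHermitian hdis hH
  have hu0 : u 0 = tensor hsub ρ τ := evolution_zero _ _
  have hu1 : ∀ s, 0 ≤ s → traceNorm (u s) ≤ 1 := fun s hs =>
    (traceNorm_evolution_le hdis hH hs).trans hst.traceNorm_eq_one.le
  have hkill : ∀ Z ⊆ region 𝓑, (∀ z ∈ Z, depth A m z ≠ 0) → F.bulkNorm (u 0) Z = 0 := by
    intro Z hZ hz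
    -- Positive depth means lying in the `m`-neighbourhood of `A`, which `A(m)` contains.
    have hZA : Z ⊆ region 𝓐 := fun z hzZ => by
      by_contra hn
      exact hz z hzZ (depth_eq_zero fun h => hn (h𝓐.2.1 h))
    rw [UniformFamily.bulkNorm_of_subset _ hZ, hu0]
    have h1 := extend_tensor hZA hsub (F.bulk Z) ρ τ
    rw [hFF 𝓐 h𝓐.1 ρ hρ Z hZA, tensor_zero] at h1
    rw [h1, traceNorm_zero]
  have hsite : ∀ s, 0 ≤ s → ∀ x ∈ A, ν m * F.siteNorm (u s) x ≤ (v + β) * Real.exp (v * s) := by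
    intro s hs x hx
    have hxB : x ∈ region 𝓑 := h𝓑.2.1 (Finset.mem_biUnion.2
      ⟨x, hx, mem_ball.2 (by rw [siteDist_self]; exact Nat.zero_le _)⟩)
    refine le_trans ?_ (hLR.siteNorm_le hu huH hu1 (depth_le_add A m) hkill
      (fun c hc d y hy => depth_le_of_mem_bdry h𝓑.1 (fun z hz => hsub (h𝓐.2.1 hz)) hc hy) hβ hs hxB)
    exact mul_le_mul_of_nonneg_right (hLR.mono (by have := le_depth m hx; omega))
      (UniformFamily.siteNorm_nonneg _ _)
  set C := A.card * κ * (v + β) + γ with hC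
  have hrate : ∀ s, 0 ≤ s → traceNorm (F.closedGen 𝓑 (u s) - F.cutGen 𝓑 A (m + 1) (u s)) ≤
      C * (ν m)⁻¹ * (Real.exp (v * s) * v + 1) := by
    intro s hs
    have h1 := UniformFamily.traceNorm_closedGen_sub_cutGen_le hLR A (m + 1) (huH s) (hu1 s hs)
    have h2 : ν m * ∑ y ∈ A, F.siteNorm (u s) y ≤ A.card * ((v + β) * Real.exp (v * s)) := by
      rw [Finset.mul_sum, ← nsmul_eq_mul]
      exact Finset.sum_le_card_nsmul _ _ _ (hsite s hs)
    have hv := hLR.nonneg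
    have h3 : A.card * ((v + β) * Real.exp (v * s)) ≤
        A.card * κ * (v + β) * (Real.exp (v * s) * v + 1) := by
      have := mul_le_mul_of_nonneg_left (hκ s) (show 0 ≤ A.card * (v + β) by positivity)
      linarith
    have h4 : γ ≤ γ * (Real.exp (v * s) * v + 1) :=
      le_mul_of_one_le_right hγ0 (by
        have : 0 ≤ Real.exp (v * s) * v := by positivity
        linarith)
    rw [mul_right_comm, ← div_eq_mul_inv, le_div_iff₀ (hLR.pos m), mul_comm]
    have h5 := mul_le_mul_of_nonneg_left h1 (hν m)
    rw [hC]
    linarith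
  intro t ht
  have hclosed := F.isDissipative_closedGen 𝓑
  -- Duhamel: the closed generator contracts the difference, and the rate bound is the derivative of
  -- the claimed bound.
  refine traceNorm_le_of_hasDerivAt hclosed
    (x := fun s => evolution (F.closedGen 𝓑) s (tensor hsub ρ τ) - u s)
    (w := fun s => F.closedGen 𝓑 (u s) - F.cutGen 𝓑 A (m + 1) (u s))
    (B := fun s => C * (ν m)⁻¹ * (Real.exp (v * s) - 1 + s))
    (b := fun s => C * (ν m)⁻¹ * (Real.exp (v * s) * v + 1))
    (fun s => ?_) (fun s => (evolution_isHermitian hclosed hH s).sub (huH s))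
    (fun s => (hclosed _ (huH s)).1.sub (hdis _ (huH s)).1) (fun s => ?_) hrate ?_ ht
  · rw [map_sub, sub_add_sub_cancel]
    exact hasDerivAt_matrix_sub (hasDerivAt_evolution _ _ s) (hu s)
  · have h1 : HasDerivAt (fun s : ℝ => Real.exp (v * s)) (Real.exp (v * s) * v) s := by
      simpa using ((hasDerivAt_id s).const_mul v).exp
    exact ((h1.sub_const 1).add (hasDerivAt_id s)).const_mul _
  · simp only [hu0, evolution_zero, sub_self, traceNorm_zero]
    simp
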